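/- Let $0<q<1$. Let $U_q\mathfrak{sl}_2$ be the complex algebra with generators $K,K^{-1},E,F$ and relations $KK^{-1}=K^{-1}K=1$, $K^{\pm1}E=q^{\pm2}EK^{\pm1}$, $K^{\pm1}F=q^{\mp2}FK^{\pm1}$, $EF-FE=(K-K^{-1})/(q-q^{-1})$, with coproduct $\Delta K^{\pm1}=K^{\pm1}\otimes K^{\pm1}$, $\Delta E=E\otimes1+K\otimes E$, $\Delta F=F\otimes K^{-1}+1\otimes F$. Let $\mathrm{Pol}(\mathbb C)_q$ be the $*$-algebra generated by $z$ with $z^*z=q^2zz^*+1-q^2$, with the covariant $U_q\mathfrak{sl}_2$-action (that is, for which the multiplication is a module morphism and $\xi\cdot 1=\varepsilon(\xi)1$, $\varepsilon$ the counit) given by $K^{\pm1}z=q^{\pm2}z$, $Fz=q^{1/2}$, $Ez=-q^{1/2}z^2$, $K^{\pm1}z^*=q^{\mp2}z^*$, $Ez^*=q^{-3/2}$, $Fz^*=-q^{5/2}z^{*2}$. Let $D(U)_q'\supset\mathrm{Pol}(\mathbb C)_q$ be the space of formal series $\sum_{j,k\ge 0} a_{jk}z^jz^{*k}$ with coefficientwise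 convergence, to which the action extends by continuity. It is identified with the space of all infinite matrices $(f_{mn})_{m,n\ge0}$ through the Fock representation $ze_m=(1-q^{2(m+1)})^{1/2}e_{m+1}$, $z^*e_m=(1-q^{2m})^{1/2}e_{m-1}$ (with $z^*e_0=0$). Let $D(U)_q\subset D(U)_q'$ be the $*$-algebra of matrices with finitely many nonzero entries (equivalently, of those $f$ with $z^{*N}f=fz^N=0$ for some $N$); it is a $U_q\mathfrak{sl}_2$-submodule. Let $\Omega(U)_q^{(0,1)}=\{f\,dz^*: f\in D(U)_q\}$, where $dz^*z=q^2z\,dz^*$, $dz^*z^*=q^{-2}z^*dz^*$. Let $\bar\partial:D(U)_q\to\Omega(U)_q^{(0,1)}$ be the restriction of the continuous extension to $D(U)_q'$ of the derivation of $\mathrm{Pol}(\mathbb C)_q$ with $\bar\partial z=0$, $\bar\partial z^*=dz^*$. The space $\Omega(U)_q^{(0,1)}$ carries the $U_q\mathfrak{sl}_2$-action determined by covariance of the left multiplication by functions and by $\xi(dz^*)=\bar\partial(\xi z^*)$ for $\xi\in\{K^{\pm1},E,F\}$. Put $\int_{U_q}f\,d\nu=(1-q^2)\sum_{m\ge0}f_{mm}q^{-2m}$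 for $f\in D(U)_q$. Let $L^2(d\nu)_q$ and $L^2(d\mu)_q$ be the Hilbert space completions of $D(U)_q$ and $\Omega(U)_q^{(0,1)}$ with respect to the scalar products $$(f_1,f_2)=\int_{U_q}f_2^*f_1\,d\nu,\qquad (f_1dz^*,f_2dz^*)=\int_{U_q}f_2^*f_1(1-zz^*)^2\,d\nu .$$ The operator $\bar\partial$ is bounded for these norms. Denote its continuous extension again by $\bar\partial:L^2(d\nu)_q\to L^2(d\mu)_q$, let $\bar\partial^*:L^2(d\mu)_q\to L^2(d\nu)_q$ be the adjoint operator, and let $\Box=-\bar\partial^*\bar\partial:L^2(d\nu)_q\to L^2(d\nu)_q$ be the Laplace–Beltrami operator. **Theorem 4.3.** The restrictions of $\bar\partial^*$ and $\Box$ to the dense linear subspaces $\Omega(U)_q^{(0,1)}\subset L^2(d\mu)_q$ and $D(U)_q\subset L^2(d\nu)_q$, respectively, take values in $D(U)_q$ and are morphisms of $U_q\mathfrak{sl}_2$-modules $\Omega(U)_q^{(0,1)}\to D(U)_q$ and $D(U)_q\to D(U)_q$. -/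

import Mathlib

open scoped ComplexConjugate

noncomputable section

namespace QDisc

/-- The range of the deformation parameter: `0 < q < 1`. -/
abbrev Par := Set.Ioo (0 : ℝ) 1

/-- `q` as a complex number. -/
def qc (q : Par) : ℂ := ((q : ℝ) : ℂ)

/-- The positive square root `q^{1/2}` as a complex number. -/
def sq (q : Par) : ℂ := ((Real.sqrt (q : ℝ) : ℝ) : ℂ)

theorem qc_ne_zero (q : Par) : qc q ≠ 0 := by
  unfold qc; exact_mod_cast q.2.1.ne'

theorem one_sub_pos (q : Par) : 0 < 1 - (q : ℝ) ^ 2 := by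
  have := q.2.1; have := q.2.2; nlinarith

theorem one_sub_ne_zero (q : Par) : 1 - qc q ^ 2 ≠ 0 := by
  unfold qc; exact_mod_cast (one_sub_pos q).ne'

theorem sq_mul_sq (q : Par) : sq q * sq q = qc q := by
  unfold sq qc; exact_mod_cast Real.mul_self_sqrt q.2.1.le

theorem q_sub_inv_ne_zero (q : Par) : qc q - (qc q)⁻¹ ≠ 0 := by
  have h := qc_ne_zero q
  have h2 := one_sub_ne_zero q
  intro h3
  apply h2
  field_simp at h3
  linear_combination -h3

/-! ### The quantum universal enveloping algebra -/

inductive UqGen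
  | K | Kinv | E | F

/-- The defining relations of `U_q sl₂`. -/
inductive UqRel (q : Par) : FreeAlgebra ℂ UqGen → FreeAlgebra ℂ UqGen → Prop
  | K_Kinv : UqRel q (FreeAlgebra.ι ℂ .K * FreeAlgebra.ι ℂ .Kinv) 1
  | Kinv_K : UqRel q (FreeAlgebra.ι ℂ .Kinv * FreeAlgebra.ι ℂ .K) 1
  | K_E : UqRel q (FreeAlgebra.ι ℂ .K * FreeAlgebra.ι ℂ .E)
      (qc q ^ 2 • (FreeAlgebra.ι ℂ .E * FreeAlgebra.ι ℂ .K))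
  | Kinv_E : UqRel q (FreeAlgebra.ι ℂ .Kinv * FreeAlgebra.ι ℂ .E)
      ((qc q ^ 2)⁻¹ • (FreeAlgebra.ι ℂ .E * FreeAlgebra.ι ℂ .Kinv))
  | K_F : UqRel q (FreeAlgebra.ι ℂ .K * FreeAlgebra.ι ℂ .F)
      ((qc q ^ 2)⁻¹ • (FreeAlgebra.ι ℂ .F * FreeAlgebra.ι ℂ .K))
  | Kinv_F : UqRel q (FreeAlgebra.ι ℂ .Kinv * FreeAlgebra.ι ℂ .F)
      (qc q ^ 2 • (FreeAlgebra.ι ℂ .F * FreeAlgebra.ι ℂ .Kinv))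
  | E_F : UqRel q
      (FreeAlgebra.ι ℂ .E * FreeAlgebra.ι ℂ .F - FreeAlgebra.ι ℂ .F * FreeAlgebra.ι ℂ .E)
      ((qc q - (qc q)⁻¹)⁻¹ • (FreeAlgebra.ι ℂ .K - FreeAlgebra.ι ℂ .Kinv))

/-- The algebra `U_q sl₂` on the generators `K, K⁻¹, E, F`. -/
abbrev Uq (q : Par) := RingQuot (UqRel q)

/-- The generators as elements of `U_q sl₂`. -/
def Uq.gen (q : Par) (g : UqGen) : Uq q :=
  RingQuot.mkAlgHom ℂ (UqRel q) (FreeAlgebra.ι ℂ g)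

theorem Uq.induction (q : Par) {P : Uq q → Prop} (hs : ∀ c : ℂ, P (algebraMap ℂ (Uq q) c))
    (hg : ∀ g, P (Uq.gen q g)) (hm : ∀ a b, P a → P b → P (a * b))
    (ha : ∀ a b, P a → P b → P (a + b)) (x : Uq q) : P x := by
  obtain ⟨y, rfl⟩ := RingQuot.mkAlgHom_surjective ℂ (UqRel q) x
  induction y using FreeAlgebra.induction with
  | grade0 r => rw [AlgHom.commutes]; exact hs r
  | grade1 g => exact hg g
  | mul a b h1 h2 => rw [map_mul]; exact hm _ _ h1 h2
  | add a b h1 h2 => rw [map_add]; exact ha _ _ h1 h2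

/-- A representation of `U_q sl₂` given by operators that satisfy the defining relations. -/
def Uq.lift (q : Par) {V : Type} [AddCommGroup V] [Module ℂ V] (k k' e f : Module.End ℂ V)
    (h1 : k * k' = 1) (h2 : k' * k = 1)
    (h3 : k * e = qc q ^ 2 • (e * k)) (h4 : k' * e = (qc q ^ 2)⁻¹ • (e * k'))
    (h5 : k * f = (qc q ^ 2)⁻¹ • (f * k)) (h6 : k' * f = qc q ^ 2 • (f * k'))
    (h7 : e * f - f * e = (qc q - (qc q)⁻¹)⁻¹ • (k - k')) :
    Uq q →ₐ[ℂ] Module.End ℂ V :=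
  RingQuot.liftAlgHom ℂ ⟨FreeAlgebra.lift ℂ (fun g => match g with
    | .K => k | .Kinv => k' | .E => e | .F => f), by
      intro x y h
      cases h <;> simp [h1, h2, h3, h4, h5, h6, h7]⟩

theorem Uq.lift_gen (q : Par) {V : Type} [AddCommGroup V] [Module ℂ V] (k k' e f : Module.End ℂ V)
    (h1 h2 h3 h4 h5 h6 h7) (g : UqGen) :
    Uq.lift q k k' e f h1 h2 h3 h4 h5 h6 h7 (Uq.gen q g) =
      (match g with | .K => k | .Kinv => k' | .E => e | .F => f) := by
  simp [Uq.lift, Uq.gen]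

/-! ### The polynomial algebra on the quantum plane, as a covariant algebra -/

inductive PolGen
  | z | zs

/-- The relation `z* z = q² z z* + 1 - q²`. -/
inductive PolRel (q : Par) : FreeAlgebra ℂ PolGen → FreeAlgebra ℂ PolGen → Prop
  | comm : PolRel q (FreeAlgebra.ι ℂ .zs * FreeAlgebra.ι ℂ .z)
      (qc q ^ 2 • (FreeAlgebra.ι ℂ .z * FreeAlgebra.ι ℂ .zs) + algebraMap ℂ _ (1 - qc q ^ 2))

/-- The algebra `Pol(ℂ)_q` with generators `z`, `z*`. -/
abbrev Pol (q : Par) := RingQuot (PolRel q)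

def z (q : Par) : Pol q := RingQuot.mkAlgHom ℂ (PolRel q) (FreeAlgebra.ι ℂ .z)

def zs (q : Par) : Pol q := RingQuot.mkAlgHom ℂ (PolRel q) (FreeAlgebra.ι ℂ .zs)

theorem zs_mul_z (q : Par) :
    zs q * z q = qc q ^ 2 • (z q * zs q) + algebraMap ℂ _ (1 - qc q ^ 2) := by
  have h := RingQuot.mkAlgHom_rel ℂ (PolRel.comm (q := q))
  rw [map_mul, map_add, map_smul, map_mul, AlgHom.commutes] at h
  exact h

theorem Pol.induction (q : Par) {P : Pol q → Prop} (hs : ∀ c : ℂ, P (algebraMap ℂ (Pol q) c))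
    (hz : P (z q)) (hzs : P (zs q)) (hm : ∀ a b, P a → P b → P (a * b))
    (ha : ∀ a b, P a → P b → P (a + b)) (x : Pol q) : P x := by
  obtain ⟨y, rfl⟩ := RingQuot.mkAlgHom_surjective ℂ (PolRel q) x
  induction y using FreeAlgebra.induction with
  | grade0 r => rw [AlgHom.commutes]; exact hs r
  | grade1 g => cases g <;> assumption
  | mul a b h1 h2 => rw [map_mul]; exact hm _ _ h1 h2
  | add a b h1 h2 => rw [map_add]; exact ha _ _ h1 h2

def Pol.lift (q : Par) {A : Type} [Ring A] [Algebra ℂ A] (a b : A)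
    (h : b * a = qc q ^ 2 • (a * b) + algebraMap ℂ A (1 - qc q ^ 2)) : Pol q →ₐ[ℂ] A :=
  RingQuot.liftAlgHom ℂ ⟨FreeAlgebra.lift ℂ (fun g => match g with | .z => a | .zs => b), by
    intro x y hxy
    cases hxy
    rw [map_mul, map_add, map_smul, map_mul, AlgHom.commutes]
    simpa using h⟩

@[simp] theorem Pol.lift_z (q : Par) {A : Type} [Ring A] [Algebra ℂ A] (a b : A) (h) :
    Pol.lift q a b h (z q) = a := by
  simp [Pol.lift, z]

@[simp] theorem Pol.lift_zs (q : Par) {A : Type} [Ring A] [Algebra ℂ A] (a b : A) (h) :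
    Pol.lift q a b h (zs q) = b := by
  simp [Pol.lift, zs]

/-- The action of `K` on `Pol(ℂ)_q`: the automorphism with `K z = q² z`, `K z* = q⁻² z*`. -/
def polK (q : Par) : Pol q →ₐ[ℂ] Pol q :=
  Pol.lift q (qc q ^ 2 • z q) ((qc q ^ 2)⁻¹ • zs q) (by
    have := qc_ne_zero q
    simp only [smul_mul_smul_comm, zs_mul_z]
    simp [this])

/-- The action of `K⁻¹` on `Pol(ℂ)_q`. -/
def polKinv (q : Par) : Pol q →ₐ[ℂ] Pol q :=
  Pol.lift q ((qc q ^ 2)⁻¹ • z q) (qc q ^ 2 • zs q) (by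
    have := qc_ne_zero q
    simp only [smul_mul_smul_comm, zs_mul_z]
    simp [this])

/-- For algebra endomorphisms `k₁, k₂` of `Pol(ℂ)_q`: the algebra homomorphism
`p ↦ (k₁ p, δ p; 0, k₂ p)` into triangular matrices, where `δ` is the twisted derivation,
`δ (p r) = k₁ p δ r + δ p k₂ r`, with `δ z = a`, `δ z* = b`. -/
def triHom (q : Par) (k₁ k₂ : Pol q →ₐ[ℂ] Pol q) (a b : Pol q)
    (h : k₁ (zs q) * a + b * k₂ (z q) = qc q ^ 2 • (k₁ (z q) * b + a * k₂ (zs q))) :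
    Pol q →ₐ[ℂ] Matrix (Fin 2) (Fin 2) (Pol q) :=
  Pol.lift q !![k₁ (z q), a; 0, k₂ (z q)] !![k₁ (zs q), b; 0, k₂ (zs q)] (by
    have e1 := congrArg k₁ (zs_mul_z q)
    have e2 := congrArg k₂ (zs_mul_z q)
    rw [map_mul, map_add, map_smul, map_mul, AlgHom.commutes] at e1 e2
    generalize 1 - qc q ^ 2 = c at e1 e2 ⊢
    ext i j
    fin_cases i <;> fin_cases j <;>
      simp [Matrix.mul_apply, Fin.sum_univ_two, Matrix.algebraMap_matrix_apply, e1, e2, h])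

/-- The twisted derivation `δ` of `Pol(ℂ)_q` with `δ z = a`, `δ z* = b`. -/
def twDer (q : Par) (k₁ k₂ : Pol q →ₐ[ℂ] Pol q) (a b : Pol q)
    (h : k₁ (zs q) * a + b * k₂ (z q) = qc q ^ 2 • (k₁ (z q) * b + a * k₂ (zs q))) :
    Pol q →ₗ[ℂ] Pol q where
  toFun p := triHom q k₁ k₂ a b h p 0 1
  map_add' := by simp
  map_smul' := by simp

section twDer

variable (q : Par) (k₁ k₂ : Pol q →ₐ[ℂ] Pol q) (a b : Pol q)
    (h : k₁ (zs q) * a + b * k₂ (z q) = qc q ^ 2 • (k₁ (z q) * b + a * k₂ (zs q)))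

theorem triHom_eq (p : Pol q) :
    triHom q k₁ k₂ a b h p = !![k₁ p, twDer q k₁ k₂ a b h p; 0, k₂ p] := by
  induction p using Pol.induction with
  | hs c =>
    ext i j
    fin_cases i <;> fin_cases j <;> simp [Matrix.algebraMap_matrix_apply, twDer]
  | hz => ext i j; fin_cases i <;> fin_cases j <;> simp [twDer, triHom]
  | hzs => ext i j; fin_cases i <;> fin_cases j <;> simp [twDer, triHom]
  | hm x y hx hy =>
    have key : triHom q k₁ k₂ a b h (x * y) =
        !![k₁ (x * y), k₁ x * twDer q k₁ k₂ a b h y + twDer q k₁ k₂ a b h x * k₂ y;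
          0, k₂ (x * y)] := by
      rw [map_mul, hx, hy]
      ext i j
      fin_cases i <;> fin_cases j <;> simp [Matrix.mul_apply, Fin.sum_univ_two]
    have h2 : twDer q k₁ k₂ a b h (x * y) =
        k₁ x * twDer q k₁ k₂ a b h y + twDer q k₁ k₂ a b h x * k₂ y := by
      exact congrFun (congrFun key 0) 1
    rw [key, h2]
  | ha x y hx hy => rw [map_add, hx, hy]; ext i j; fin_cases i <;> fin_cases j <;> simp

theorem twDer_mul (p r : Pol q) : twDer q k₁ k₂ a b h (p * r) =
    k₁ p * twDer q k₁ k₂ a b h r + twDer q k₁ k₂ a b h p * k₂ r := by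
  have := congrFun (congrFun (triHom_eq q k₁ k₂ a b h (p * r)) 0) 1
  rw [map_mul, triHom_eq, triHom_eq] at this
  simpa [Matrix.mul_apply, Fin.sum_univ_two] using this.symm

@[simp] theorem twDer_z : twDer q k₁ k₂ a b h (z q) = a := by simp [twDer, triHom]

@[simp] theorem twDer_zs : twDer q k₁ k₂ a b h (zs q) = b := by simp [twDer, triHom]

theorem twDer_algebraMap (c : ℂ) : twDer q k₁ k₂ a b h (algebraMap ℂ _ c) = 0 := by
  simp [twDer, Matrix.algebraMap_matrix_apply]

end twDer

theorem zs_mul_z_sq (q : Par) : zs q * z q ^ 2 =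
    qc q ^ 4 • (z q ^ 2 * zs q) + ((qc q ^ 2 + 1) * (1 - qc q ^ 2)) • z q := by
  rw [pow_two, ← mul_assoc, zs_mul_z, add_mul, smul_mul_assoc, mul_assoc (z q), zs_mul_z,
    Algebra.algebraMap_eq_smul_one]
  simp only [mul_add, mul_smul_comm, smul_mul_assoc, mul_one, one_mul, smul_add, mul_assoc]
  module

theorem zs_sq_mul_z (q : Par) : zs q ^ 2 * z q =
    qc q ^ 4 • (z q * zs q ^ 2) + ((qc q ^ 2 + 1) * (1 - qc q ^ 2)) • zs q := by
  rw [pow_two, mul_assoc, zs_mul_z, mul_add, mul_smul_comm, ← mul_assoc (zs q) (z q), zs_mul_z,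
    Algebra.algebraMap_eq_smul_one]
  simp only [add_mul, mul_smul_comm, smul_mul_assoc, mul_one, one_mul, smul_add, mul_assoc]
  module

/-- The action of `E` on `Pol(ℂ)_q`: `E z = -q^{1/2} z²`, `E z* = q^{-3/2}`, and
`E (p r) = E p · r + K p · E r`, according to the coproduct `Δ E = E ⊗ 1 + K ⊗ E`. -/
def polE (q : Par) : Pol q →ₗ[ℂ] Pol q :=
  twDer q (polK q) (AlgHom.id ℂ _) (-sq q • z q ^ 2) (algebraMap ℂ _ (sq q / qc q ^ 2)) (by
    have h0 := qc_ne_zero q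
    simp only [polK, Pol.lift_z, Pol.lift_zs, AlgHom.id_apply, Algebra.algebraMap_eq_smul_one,
      smul_mul_assoc, mul_smul_comm, one_mul, mul_one, zs_mul_z_sq]
    match_scalars <;> field_simp
    ring)

/-- The action of `F` on `Pol(ℂ)_q`: `F z = q^{1/2}`, `F z* = -q^{5/2} z*²`, and
`F (p r) = F p · K⁻¹ r + p · F r`, according to the coproduct `Δ F = F ⊗ K⁻¹ + 1 ⊗ F`. -/
def polF (q : Par) : Pol q →ₗ[ℂ] Pol q :=
  twDer q (AlgHom.id ℂ _) (polKinv q) (algebraMap ℂ _ (sq q)) (-(sq q * qc q ^ 2) • zs q ^ 2) (by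
    have h0 := qc_ne_zero q
    simp only [polKinv, Pol.lift_z, Pol.lift_zs, AlgHom.id_apply, Algebra.algebraMap_eq_smul_one,
      smul_mul_assoc, mul_smul_comm, one_mul, mul_one, zs_sq_mul_z]
    match_scalars <;> field_simp
    ring)

/-- The coefficient `p'` of `∂̄ p = p' dz*`, `p ∈ Pol(ℂ)_q`: `∂̄ z = 0`, `∂̄ z* = dz*`, and
`∂̄ (p r) = (∂̄ p) r + p (∂̄ r)`, where the (0,1)-forms `Pol(ℂ)_q dz*` have the bimodule structure
`dz* z = q² z dz*`, `dz* z* = q⁻² z* dz*`, that is, `dz* r = (K r) dz*`. -/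
def polDbar (q : Par) : Pol q →ₗ[ℂ] Pol q :=
  twDer q (AlgHom.id ℂ _) (polK q) 0 1 (by
    simp [polK])

/-! ### Distributions in the quantum disc

Distributions are the formal series `∑ a_{jk} z^j z*^k`. A series is identified with the infinite
matrix of its Fock representation, `z e_m = (1 - q^{2(m+1)})^{1/2} e_{m+1}`,
`z* e_m = (1 - q^{2m})^{1/2} e_{m-1}`; each matrix element involves finitely many of the `a_{jk}`
and conversely, so that coefficientwise convergence is convergence of all matrix elements. -/

/-- The space of distributions, with the topology of convergence of all matrix elements. -/
abbrev Dist := ℕ → ℕ → ℂ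

/-- The weight `(1 - q^{2m})^{1/2}`. -/
def wt (q : Par) (m : ℕ) : ℂ := ((Real.sqrt (1 - (q : ℝ) ^ (2 * m)) : ℝ) : ℂ)

theorem wt_zero (q : Par) : wt q 0 = 0 := by simp [wt]

theorem wt_mul_wt (q : Par) (m : ℕ) : wt q m * wt q m = 1 - qc q ^ (2 * m) := by
  have h : 0 ≤ 1 - (q : ℝ) ^ (2 * m) := by
    have := pow_le_one₀ (n := 2 * m) q.2.1.le q.2.2.le
    linarith
  unfold wt qc
  exact_mod_cast Real.mul_self_sqrt h

/-- Left multiplication `f ↦ z f`. -/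
def lz (q : Par) : Module.End ℂ Dist where
  toFun f := fun m n => wt q m * f (m - 1) n
  map_add' f g := by ext m n; simp [mul_add]
  map_smul' c f := by ext m n; simp [mul_left_comm]

/-- Left multiplication `f ↦ z* f`. -/
def lzs (q : Par) : Module.End ℂ Dist where
  toFun f := fun m n => wt q (m + 1) * f (m + 1) n
  map_add' f g := by ext m n; simp [mul_add]
  map_smul' c f := by ext m n; simp [mul_left_comm]

/-- Right multiplication `f ↦ f z`. -/
def rz (q : Par) : Module.End ℂ Dist where
  toFun f := fun m n => wt q (n + 1) * f m (n + 1)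
  map_add' f g := by ext m n; simp [mul_add]
  map_smul' c f := by ext m n; simp [mul_left_comm]

/-- Right multiplication `f ↦ f z*`. -/
def rzs (q : Par) : Module.End ℂ Dist where
  toFun f := fun m n => wt q n * f m (n - 1)
  map_add' f g := by ext m n; simp [mul_add]
  map_smul' c f := by ext m n; simp [mul_left_comm]

/-- Entrywise multiplication by `a m n`. -/
def diagOp (a : ℕ → ℕ → ℂ) : Module.End ℂ Dist where
  toFun f := fun m n => a m n * f m n
  map_add' f g := by ext m n; simp [mul_add]
  map_smul' c f := by ext m n; simp [mul_left_comm]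

theorem lzs_mul_lz (q : Par) :
    lzs q * lz q = qc q ^ 2 • (lz q * lzs q) + algebraMap ℂ _ (1 - qc q ^ 2) := by
  ext f m n
  simp only [Module.End.mul_apply, LinearMap.add_apply, LinearMap.smul_apply,
    Module.algebraMap_end_apply, Pi.add_apply, Pi.smul_apply, smul_eq_mul, lz, lzs,
    LinearMap.coe_mk, AddHom.coe_mk]
  have h1 := wt_mul_wt q (m + 1)
  rcases m with _ | m
  · simp only [wt_zero, Nat.add_sub_cancel]
    linear_combination (f 0 n) * h1
  · have h2 := wt_mul_wt q (m + 1)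
    simp only [Nat.add_sub_cancel]
    linear_combination (f (m + 1) n) * h1 - qc q ^ 2 * (f (m + 1) n) * h2

theorem rz_mul_rzs (q : Par) :
    rz q * rzs q = qc q ^ 2 • (rzs q * rz q) + algebraMap ℂ _ (1 - qc q ^ 2) := by
  ext f m n
  simp only [Module.End.mul_apply, LinearMap.add_apply, LinearMap.smul_apply,
    Module.algebraMap_end_apply, Pi.add_apply, Pi.smul_apply, smul_eq_mul, rz, rzs,
    LinearMap.coe_mk, AddHom.coe_mk]
  have h1 := wt_mul_wt q (n + 1)
  rcases n with _ | n
  · simp only [wt_zero, Nat.add_sub_cancel]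
    linear_combination (f m 0) * h1
  · have h2 := wt_mul_wt q (n + 1)
    simp only [Nat.add_sub_cancel]
    linear_combination (f m (n + 1)) * h1 - qc q ^ 2 * (f m (n + 1)) * h2

/-- Left multiplication of distributions by elements of `Pol(ℂ)_q`. -/
def lMul (q : Par) : Pol q →ₐ[ℂ] Module.End ℂ Dist :=
  Pol.lift q (lz q) (lzs q) (lzs_mul_lz q)

/-- Right multiplication of distributions by elements of `Pol(ℂ)_q`. -/
def rMul (q : Par) : Pol q →ₐ[ℂ] (Module.End ℂ Dist)ᵐᵒᵖ :=
  Pol.lift q (MulOpposite.op (rz q)) (MulOpposite.op (rzs q)) (by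
    rw [← MulOpposite.op_mul, rz_mul_rzs]; rfl)

/-- `f ↦ f p`. -/
def rightMul (q : Par) (p : Pol q) : Module.End ℂ Dist := MulOpposite.unop (rMul q p)

/-- The embedding of `Pol(ℂ)_q` in the space of distributions. -/
def ofPol (q : Par) (p : Pol q) : Dist := lMul q p (fun m n => if m = n then 1 else 0)

/-! ### The action of `U_q sl₂` on distributions

The operators below are the continuous extensions of the action on `Pol(ℂ)_q`: see
`denseRange_ofPol`, `distK_ofPol`, `distKinv_ofPol`, `distE_ofPol`, `distF_ofPol`
and the continuity statements. -/

/-- `K` multiplies the matrix element `f m n` by `q^{2m - 2n}`. -/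
def distK (q : Par) : Module.End ℂ Dist := diagOp fun m n => qc q ^ (2 * (m : ℤ) - 2 * (n : ℤ))

def distKinv (q : Par) : Module.End ℂ Dist := diagOp fun m n => qc q ^ (2 * (n : ℤ) - 2 * (m : ℤ))

/-- `E f = -q^{1/2} (1 - q²)⁻¹ (z f - K(f) z)`. -/
def distE (q : Par) : Module.End ℂ Dist :=
  (-(sq q / (1 - qc q ^ 2))) • (lz q - rz q * distK q)

/-- `F f = q^{5/2} (1 - q²)⁻¹ (z* K⁻¹(f) - f z*)`. -/
def distF (q : Par) : Module.End ℂ Dist :=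
  (sq q * qc q ^ 2 / (1 - qc q ^ 2)) • (lzs q * distKinv q - rzs q)

/-- The coefficient `g` of `∂̄ f = g dz*`, for a distribution `f`: the continuous extension
of `polDbar`, see `distDbar_ofPol`. Explicitly `g = (1 - q²)⁻¹ (f z - z f) (1 - z z*)⁻¹`. -/
def distDbar (q : Par) : Module.End ℂ Dist :=
  diagOp (fun _ n => ((1 - qc q ^ 2) * qc q ^ (2 * n))⁻¹) * (rz q - lz q)

section relations

variable (q : Par)

theorem distK_mul_distKinv : distK q * distKinv q = 1 := by
  ext f m n
  simp only [distK, distKinv, diagOp, Module.End.mul_apply, LinearMap.coe_mk, AddHom.coe_mk,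
    Module.End.one_apply, ← mul_assoc, ← zpow_add₀ (qc_ne_zero q)]
  simp

theorem distKinv_mul_distK : distKinv q * distK q = 1 := by
  ext f m n
  simp only [distK, distKinv, diagOp, Module.End.mul_apply, LinearMap.coe_mk, AddHom.coe_mk,
    Module.End.one_apply, ← mul_assoc, ← zpow_add₀ (qc_ne_zero q)]
  simp

theorem lzs_lz_apply (f : Dist) : lzs q (lz q f) = qc q ^ 2 • lz q (lzs q f)
    + (1 - qc q ^ 2) • f := by
  exact LinearMap.congr_fun (lzs_mul_lz q) f

theorem rz_rzs_apply (f : Dist) : rz q (rzs q f) = qc q ^ 2 • rzs q (rz q f)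
    + (1 - qc q ^ 2) • f := by
  exact LinearMap.congr_fun (rz_mul_rzs q) f

theorem rz_lz (f : Dist) : rz q (lz q f) = lz q (rz q f) := by
  ext m n; simp [rz, lz]; ring

theorem rz_lzs (f : Dist) : rz q (lzs q f) = lzs q (rz q f) := by
  ext m n; simp [rz, lzs]; ring

theorem rzs_lz (f : Dist) : rzs q (lz q f) = lz q (rzs q f) := by
  ext m n; simp [rzs, lz]; ring

theorem rzs_lzs (f : Dist) : rzs q (lzs q f) = lzs q (rzs q f) := by
  ext m n; simp [rzs, lzs]; ring

theorem distK_lz (f : Dist) : distK q (lz q f) = qc q ^ 2 • lz q (distK q f) := by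
  ext m n
  simp only [distK, diagOp, lz, LinearMap.coe_mk, AddHom.coe_mk, Pi.smul_apply, smul_eq_mul]
  rcases m with _ | m
  · simp [wt_zero]
  · rw [show 2 * ((m + 1 : ℕ) : ℤ) - 2 * (n : ℤ) = 2 + (2 * (m : ℤ) - 2 * (n : ℤ)) by
      push_cast; ring, zpow_add₀ (qc_ne_zero q)]
    simp only [Nat.add_sub_cancel, zpow_ofNat]; ring

theorem distK_lzs (f : Dist) : distK q (lzs q f) = (qc q ^ 2)⁻¹ • lzs q (distK q f) := by
  have h0 := qc_ne_zero q
  ext m n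
  simp only [distK, diagOp, lzs, LinearMap.coe_mk, AddHom.coe_mk, Pi.smul_apply, smul_eq_mul]
  rw [show 2 * ((m + 1 : ℕ) : ℤ) - 2 * (n : ℤ) = 2 + (2 * (m : ℤ) - 2 * (n : ℤ)) by
      push_cast; ring, zpow_add₀ (qc_ne_zero q), zpow_ofNat]
  field_simp

theorem distK_rz (f : Dist) : distK q (rz q f) = qc q ^ 2 • rz q (distK q f) := by
  have h0 := qc_ne_zero q
  ext m n
  simp only [distK, diagOp, rz, LinearMap.coe_mk, AddHom.coe_mk, Pi.smul_apply, smul_eq_mul]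
  rw [show 2 * (m : ℤ) - 2 * (n : ℤ) = 2 + (2 * (m : ℤ) - 2 * ((n + 1 : ℕ) : ℤ)) by
      push_cast; ring, zpow_add₀ (qc_ne_zero q), zpow_ofNat]
  ring

theorem distK_rzs (f : Dist) : distK q (rzs q f) = (qc q ^ 2)⁻¹ • rzs q (distK q f) := by
  have h0 := qc_ne_zero q
  ext m n
  simp only [distK, diagOp, rzs, LinearMap.coe_mk, AddHom.coe_mk, Pi.smul_apply, smul_eq_mul]
  rcases n with _ | n
  · simp [wt_zero]
  · rw [show 2 * (m : ℤ) - 2 * ((n + 1 - 1 : ℕ) : ℤ)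
        = 2 + (2 * (m : ℤ) - 2 * ((n + 1 : ℕ) : ℤ)) by
      simp; ring, zpow_add₀ (qc_ne_zero q), zpow_ofNat]
    field_simp

theorem distKinv_distK (f : Dist) : distKinv q (distK q f) = f :=
  LinearMap.congr_fun (distKinv_mul_distK q) f

theorem distK_distKinv (f : Dist) : distK q (distKinv q f) = f :=
  LinearMap.congr_fun (distK_mul_distKinv q) f

theorem distK_eq_iff (f g : Dist) : distK q f = g ↔ f = distKinv q g :=
  ⟨fun h => by rw [← h, distKinv_distK], fun h => by rw [h, distK_distKinv]⟩

theorem distKinv_lz (f : Dist) : distKinv q (lz q f) = (qc q ^ 2)⁻¹ • lz q (distKinv q f) := by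
  have h0 := qc_ne_zero q
  rw [eq_comm, ← distK_eq_iff, map_smul, distK_lz, distK_distKinv, smul_smul,
    inv_mul_cancel₀ (pow_ne_zero 2 h0), one_smul]

theorem distKinv_lzs (f : Dist) : distKinv q (lzs q f) = qc q ^ 2 • lzs q (distKinv q f) := by
  have h0 := qc_ne_zero q
  rw [eq_comm, ← distK_eq_iff, map_smul, distK_lzs, distK_distKinv, smul_smul,
    mul_inv_cancel₀ (pow_ne_zero 2 h0), one_smul]

theorem distKinv_rz (f : Dist) : distKinv q (rz q f) = (qc q ^ 2)⁻¹ • rz q (distKinv q f) := by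
  have h0 := qc_ne_zero q
  rw [eq_comm, ← distK_eq_iff, map_smul, distK_rz, distK_distKinv, smul_smul,
    inv_mul_cancel₀ (pow_ne_zero 2 h0), one_smul]

theorem distKinv_rzs (f : Dist) : distKinv q (rzs q f) = qc q ^ 2 • rzs q (distKinv q f) := by
  have h0 := qc_ne_zero q
  rw [eq_comm, ← distK_eq_iff, map_smul, distK_rzs, distK_distKinv, smul_smul,
    mul_inv_cancel₀ (pow_ne_zero 2 h0), one_smul]

theorem distE_apply (f : Dist) :
    distE q f = (-(sq q / (1 - qc q ^ 2))) • (lz q f - rz q (distK q f)) := by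
  simp [distE]

theorem distF_apply (f : Dist) :
    distF q f = (sq q * qc q ^ 2 / (1 - qc q ^ 2)) • (lzs q (distKinv q f) - rzs q f) := by
  simp [distF]

theorem distK_distE (f : Dist) : distK q (distE q f) = qc q ^ 2 • distE q (distK q f) := by
  simp only [distE_apply, map_smul, map_sub, distK_lz, distK_rz]
  module

theorem distK_distF (f : Dist) : distK q (distF q f) = (qc q ^ 2)⁻¹ • distF q (distK q f) := by
  simp only [distF_apply, map_smul, map_sub, distK_lzs, distK_rzs, distK_distKinv,
    distKinv_distK]
  module

theorem distKinv_distE (f : Dist) :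
    distKinv q (distE q f) = (qc q ^ 2)⁻¹ • distE q (distKinv q f) := by
  have h0 := qc_ne_zero q
  rw [eq_comm, ← distK_eq_iff, map_smul, distK_distE, distK_distKinv, smul_smul,
    inv_mul_cancel₀ (pow_ne_zero 2 h0), one_smul]

theorem distKinv_distF (f : Dist) :
    distKinv q (distF q f) = qc q ^ 2 • distF q (distKinv q f) := by
  have h0 := qc_ne_zero q
  rw [eq_comm, ← distK_eq_iff, map_smul, distK_distF, distK_distKinv, smul_smul,
    mul_inv_cancel₀ (pow_ne_zero 2 h0), one_smul]

theorem distE_distF (f : Dist) : distE q (distF q f) - distF q (distE q f) =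
    (qc q - (qc q)⁻¹)⁻¹ • (distK q f - distKinv q f) := by
  have h0 := qc_ne_zero q
  have h1 := one_sub_ne_zero q
  have h2 : (qc q - (qc q)⁻¹)⁻¹ = -(qc q / (1 - qc q ^ 2)) := by
    have h3 := q_sub_inv_ne_zero q
    rw [inv_eq_iff_eq_inv, eq_comm, ← neg_inv, inv_div]
    field_simp; ring
  have h3 := sq_mul_sq q
  rw [h2]
  simp only [distE_apply, distF_apply, map_smul, map_sub, distK_lzs, distK_rzs, distK_distKinv,
    distKinv_distK, distKinv_lz, distKinv_rz, rz_lzs, rzs_lz, rz_rzs_apply, lzs_lz_apply,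
    smul_add, smul_sub, smul_smul]
  match_scalars <;> field_simp <;>
    first | ring1 | linear_combination h3 | linear_combination -h3

end relations

/-- The action of `U_q sl₂` on distributions. -/
def distAct (q : Par) : Uq q →ₐ[ℂ] Module.End ℂ Dist :=
  Uq.lift q (distK q) (distKinv q) (distE q) (distF q)
    (distK_mul_distKinv q) (distKinv_mul_distK q)
    (LinearMap.ext (distK_distE q)) (LinearMap.ext (distKinv_distE q))
    (LinearMap.ext (distK_distF q)) (LinearMap.ext (distKinv_distF q))
    (LinearMap.ext (distE_distF q))

section compatibility

variable (q : Par)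

@[simp] theorem lMul_z : lMul q (z q) = lz q := by simp [lMul]

@[simp] theorem lMul_zs : lMul q (zs q) = lzs q := by simp [lMul]

@[simp] theorem rightMul_z : rightMul q (z q) = rz q := by simp [rightMul, rMul]

@[simp] theorem rightMul_zs : rightMul q (zs q) = rzs q := by simp [rightMul, rMul]

@[simp] theorem rightMul_one : rightMul q 1 = 1 := by simp [rightMul]

theorem rightMul_mul (a b : Pol q) : rightMul q (a * b) = rightMul q b * rightMul q a := by
  simp [rightMul]

theorem rightMul_sub (a b : Pol q) : rightMul q (a - b) = rightMul q a - rightMul q b := by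
  simp [rightMul]

theorem rightMul_smul (c : ℂ) (a : Pol q) : rightMul q (c • a) = c • rightMul q a := by
  simp [rightMul]

theorem distK_lMul (p : Pol q) (f : Dist) :
    distK q (lMul q p f) = lMul q (polK q p) (distK q f) := by
  induction p using Pol.induction generalizing f with
  | hs c => simp only [AlgHom.commutes, Module.algebraMap_end_apply, map_smul]
  | hz => simp [polK, distK_lz]
  | hzs => simp [polK, distK_lzs]
  | hm a b ha hb => simp only [map_mul, Module.End.mul_apply, ha, hb]
  | ha a b ha hb => simp only [map_add, LinearMap.add_apply, ha, hb]

theorem distKinv_lMul (p : Pol q) (f : Dist) :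
    distKinv q (lMul q p f) = lMul q (polKinv q p) (distKinv q f) := by
  induction p using Pol.induction generalizing f with
  | hs c => simp only [AlgHom.commutes, Module.algebraMap_end_apply, map_smul]
  | hz => simp [polKinv, distKinv_lz]
  | hzs => simp [polKinv, distKinv_lzs]
  | hm a b ha hb => simp only [map_mul, Module.End.mul_apply, ha, hb]
  | ha a b ha hb => simp only [map_add, LinearMap.add_apply, ha, hb]

/-- The left action of `Pol(ℂ)_q` on distributions is covariant. -/
theorem distE_lMul (p : Pol q) (f : Dist) :
    distE q (lMul q p f) = lMul q (polE q p) f + lMul q (polK q p) (distE q f) := by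
  have h0 := qc_ne_zero q
  have h1 := one_sub_ne_zero q
  induction p using Pol.induction generalizing f with
  | hs c =>
    simp only [AlgHom.commutes, Module.algebraMap_end_apply, map_smul, polE, twDer_algebraMap,
      map_zero, LinearMap.zero_apply, zero_add]
  | hz =>
    simp only [polE, polK, twDer_z, Pol.lift_z, map_smul, map_mul, lMul_z, distE_apply, distK_lz,
      rz_lz, pow_two, LinearMap.smul_apply, Module.End.mul_apply, map_sub, smul_sub, smul_smul]
    match_scalars <;> field_simp
    ring
  | hzs =>
    simp only [polE, polK, twDer_zs, Pol.lift_zs, map_smul, lMul_zs, distE_apply, distK_lzs,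
      rz_lzs, AlgHom.commutes, Module.algebraMap_end_apply,
      LinearMap.smul_apply, map_sub, smul_sub, smul_smul, lzs_lz_apply, smul_add]
    match_scalars <;> field_simp
    ring
  | hm a b ha hb =>
    have : polE q (a * b) = polK q a * polE q b + polE q a * b := twDer_mul ..
    simp only [this, map_mul, map_add, LinearMap.add_apply, Module.End.mul_apply, ha, hb]
    abel
  | ha a b ha hb => simp only [map_add, LinearMap.add_apply, ha, hb]; abel

theorem distF_lMul (p : Pol q) (f : Dist) :
    distF q (lMul q p f) = lMul q (polF q p) (distKinv q f) + lMul q p (distF q f) := by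
  have h0 := qc_ne_zero q
  have h1 := one_sub_ne_zero q
  induction p using Pol.induction generalizing f with
  | hs c =>
    simp only [AlgHom.commutes, Module.algebraMap_end_apply, map_smul, polF, twDer_algebraMap,
      map_zero, LinearMap.zero_apply, zero_add]
  | hz =>
    simp only [polF, twDer_z, lMul_z, distF_apply, distKinv_lz, map_smul,
      rzs_lz, AlgHom.commutes, Module.algebraMap_end_apply,
      map_sub, smul_sub, smul_smul, lzs_lz_apply, smul_add]
    match_scalars <;> field_simp
  | hzs =>
    simp only [polF, twDer_zs, map_smul, map_mul, lMul_zs, distF_apply, distKinv_lzs,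
      rzs_lzs, pow_two, LinearMap.smul_apply, Module.End.mul_apply, map_sub, smul_sub, smul_smul]
    match_scalars <;> field_simp
    ring
  | hm a b ha hb =>
    have : polF q (a * b) = a * polF q b + polF q a * polKinv q b := twDer_mul ..
    simp only [this, map_mul, map_add, LinearMap.add_apply, Module.End.mul_apply, ha, hb,
      distKinv_lMul]
    abel
  | ha a b ha hb => simp only [map_add, LinearMap.add_apply, ha, hb]; abel

theorem distDbar_lMul (p : Pol q) (f : Dist) :
    distDbar q (lMul q p f) = lMul q (polDbar q p) (distK q f) + lMul q p (distDbar q f) := by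
  have h0 := qc_ne_zero q
  have h1 := one_sub_ne_zero q
  induction p using Pol.induction generalizing f with
  | hs c =>
    simp only [AlgHom.commutes, Module.algebraMap_end_apply, map_smul, polDbar, twDer_algebraMap,
      map_zero, LinearMap.zero_apply, zero_add]
  | hz =>
    simp only [polDbar, twDer_z, lMul_z, distDbar, Module.End.mul_apply, LinearMap.sub_apply,
      rz_lz, map_zero, LinearMap.zero_apply, zero_add, ← map_sub]
    ext m n
    simp only [diagOp, lz, LinearMap.coe_mk, AddHom.coe_mk]
    ring
  | hzs =>
    have h2 : rz q (lzs q f) - lz q (lzs q f) =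
        lzs q (rz q f - lz q f) + lzs q (lz q f) - lz q (lzs q f) := by
      rw [map_sub, rz_lzs]; abel
    have h3 : lzs q (lz q f) - lz q (lzs q f) =
        diagOp (fun m _ => (1 - qc q ^ 2) * qc q ^ (2 * m)) f := by
      ext m n
      have e1 := wt_mul_wt q (m + 1)
      rcases m with _ | m
      · simp only [lz, lzs, diagOp, LinearMap.coe_mk, AddHom.coe_mk, Pi.sub_apply, wt_zero,
          Nat.add_sub_cancel]
        linear_combination (f 0 n) * e1
      · have e2 := wt_mul_wt q (m + 1)
        simp only [lz, lzs, diagOp, LinearMap.coe_mk, AddHom.coe_mk, Pi.sub_apply,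
          Nat.add_sub_cancel]
        linear_combination (f (m + 1) n) * e1 - (f (m + 1) n) * e2
    simp only [polDbar, twDer_zs, lMul_zs, distDbar, Module.End.mul_apply, LinearMap.sub_apply,
      map_one, Module.End.one_apply]
    rw [h2, add_sub_assoc, h3, map_add, add_comm]
    congr 1
    · ext m n
      simp only [diagOp, distK, LinearMap.coe_mk, AddHom.coe_mk]
      rw [zpow_sub₀ h0]
      have e : ∀ k : ℕ, qc q ^ (2 * (k : ℤ)) = qc q ^ (2 * k) := fun k => by
        rw [← zpow_natCast]; push_cast; rfl
      rw [e, e]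
      field_simp
    · ext m n
      simp only [diagOp, lzs, LinearMap.coe_mk, AddHom.coe_mk]
      ring
  | hm a b ha hb =>
    have : polDbar q (a * b) = a * polDbar q b + polDbar q a * polK q b := twDer_mul ..
    simp only [this, map_mul, map_add, LinearMap.add_apply, Module.End.mul_apply, ha, hb,
      distK_lMul]
    abel
  | ha a b ha hb => simp only [map_add, LinearMap.add_apply, ha, hb]; abel

theorem distK_unit : distK q (fun m n => if m = n then 1 else 0) =
    fun m n => if m = n then 1 else 0 := by
  ext m n
  by_cases h : m = n <;> simp [distK, diagOp, h]

theorem distKinv_unit : distKinv q (fun m n => if m = n then 1 else 0) =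
    fun m n => if m = n then 1 else 0 := by
  ext m n
  by_cases h : m = n <;> simp [distKinv, diagOp, h]

theorem lz_unit : lz q (fun m n => if m = n then 1 else 0) =
    rz q (fun m n => if m = n then 1 else 0) := by
  ext m n
  rcases m with _ | m
  · simp [lz, rz, wt_zero]
  · by_cases h : m = n
    · simp [lz, rz, h]
    · simp [lz, rz, h]

theorem lzs_unit : lzs q (fun m n => if m = n then 1 else 0) =
    rzs q (fun m n => if m = n then 1 else 0) := by
  ext m n
  rcases n with _ | n
  · simp [lzs, rzs, wt_zero]
  · by_cases h : m = n
    · simp [lzs, rzs, h]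
    · simp [lzs, rzs, h]

theorem distK_ofPol (p : Pol q) : distK q (ofPol q p) = ofPol q (polK q p) := by
  rw [ofPol, distK_lMul, distK_unit, ofPol]

theorem distKinv_ofPol (p : Pol q) : distKinv q (ofPol q p) = ofPol q (polKinv q p) := by
  rw [ofPol, distKinv_lMul, distKinv_unit, ofPol]

theorem distE_ofPol (p : Pol q) : distE q (ofPol q p) = ofPol q (polE q p) := by
  rw [ofPol, distE_lMul, distE_apply q (fun m n => _), distK_unit, lz_unit, sub_self, smul_zero,
    map_zero, add_zero, ofPol]

theorem distF_ofPol (p : Pol q) : distF q (ofPol q p) = ofPol q (polF q p) := by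
  rw [ofPol, distF_lMul, distF_apply q (fun m n => _), distKinv_unit, lzs_unit, sub_self, smul_zero,
    map_zero, add_zero, ofPol]

theorem distDbar_ofPol (p : Pol q) : distDbar q (ofPol q p) = ofPol q (polDbar q p) := by
  rw [ofPol, distDbar_lMul, distK_unit, distDbar, Module.End.mul_apply, LinearMap.sub_apply,
    lz_unit, sub_self, map_zero, map_zero, add_zero, ofPol]

theorem continuous_lz : Continuous (lz q) := by
  refine continuous_pi fun m => continuous_pi fun n => ?_
  exact continuous_const.mul ((continuous_apply n).comp (continuous_apply (m - 1)))

theorem continuous_lzs : Continuous (lzs q) := by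
  refine continuous_pi fun m => continuous_pi fun n => ?_
  exact continuous_const.mul ((continuous_apply n).comp (continuous_apply (m + 1)))

theorem continuous_rz : Continuous (rz q) := by
  refine continuous_pi fun m => continuous_pi fun n => ?_
  exact continuous_const.mul ((continuous_apply (n + 1)).comp (continuous_apply m))

theorem continuous_rzs : Continuous (rzs q) := by
  refine continuous_pi fun m => continuous_pi fun n => ?_
  exact continuous_const.mul ((continuous_apply (n - 1)).comp (continuous_apply m))

theorem continuous_diagOp (a : ℕ → ℕ → ℂ) : Continuous (diagOp a) := by
  refine continuous_pi fun m => continuous_pi fun n => ?_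
  exact continuous_const.mul ((continuous_apply n).comp (continuous_apply m))

theorem continuous_distE : Continuous (distE q) :=
  ((continuous_lz q).sub ((continuous_rz q).comp (continuous_diagOp _))).const_smul _

theorem continuous_distF : Continuous (distF q) :=
  (((continuous_lzs q).comp (continuous_diagOp _)).sub (continuous_rzs q)).const_smul _

theorem continuous_distDbar : Continuous (distDbar q) :=
  (continuous_diagOp _).comp ((continuous_rz q).sub (continuous_lz q))

theorem lMul_y (f : Dist) :
    lMul q (1 - z q * zs q) f = fun m n => qc q ^ (2 * m) * f m n := by
  rw [map_sub, map_one, map_mul, lMul_z, lMul_zs]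
  ext m n
  have e1 := wt_mul_wt q m
  rcases m with _ | m
  · simp [lz, wt_zero]
  · simp only [LinearMap.sub_apply, Module.End.mul_apply, Module.End.one_apply, lz, lzs,
      LinearMap.coe_mk, AddHom.coe_mk, Pi.sub_apply, Nat.add_sub_cancel]
    linear_combination -(f (m + 1) n) * e1

/-- `Pol(ℂ)_q` is dense in the space of distributions. -/
theorem denseRange_ofPol : DenseRange (ofPol q) := by
  let L : Pol q →ₗ[ℂ] Dist :=
    (LinearMap.applyₗ (fun m n : ℕ => if m = n then (1 : ℂ) else 0)).comp (lMul q).toLinearMap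
  have hL : ∀ p, L p = ofPol q p := fun p => rfl
  let S : Submodule ℂ Dist := (LinearMap.range L).topologicalClosure
  have hS : IsClosed (S : Set Dist) := Submodule.isClosed_topologicalClosure _
  have hpol : ∀ p, ofPol q p ∈ S := fun p =>
    Submodule.le_topologicalClosure _ ⟨p, hL p⟩
  have hlz : ∀ f ∈ S, lz q f ∈ S := by
    intro f hf
    refine map_mem_closure (continuous_lz q) hf ?_
    rintro _ ⟨p, rfl⟩
    exact ⟨z q * p, by rw [hL, hL, ofPol, ofPol, map_mul, lMul_z]; rfl⟩
  have hcomm : ∀ p f, rzs q (lMul q p f) = lMul q p (rzs q f) := by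
    intro p f
    induction p using Pol.induction generalizing f with
    | hs c => simp only [AlgHom.commutes, Module.algebraMap_end_apply, map_smul]
    | hz => simp [rzs_lz]
    | hzs => simp [rzs_lzs]
    | hm a b ha hb => simp only [map_mul, Module.End.mul_apply, ha, hb]
    | ha a b ha hb => simp only [map_add, LinearMap.add_apply, ha, hb]
  have hrzs : ∀ f ∈ S, rzs q f ∈ S := by
    intro f hf
    refine map_mem_closure (continuous_rzs q) hf ?_
    rintro _ ⟨p, rfl⟩
    exact ⟨p * zs q, by
      rw [hL, hL, ofPol, ofPol, map_mul, lMul_zs, Module.End.mul_apply, hcomm, lzs_unit]⟩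
  let e : ℕ → ℕ → Dist := fun j k m n => if m = j ∧ n = k then 1 else 0
  have hwt : ∀ m, wt q (m + 1) ≠ 0 := by
    intro m
    have h : 0 < 1 - (q : ℝ) ^ (2 * (m + 1)) := by
      have := pow_lt_one₀ q.2.1.le q.2.2 (n := 2 * (m + 1)) (by omega)
      linarith
    unfold wt
    exact_mod_cast (Real.sqrt_pos.2 h).ne'
  have h00 : e 0 0 ∈ S := by
    let c : ℕ → ℂ := fun i => 1 - qc q ^ (2 * (i + 1))
    have hc : ∀ i, c i ≠ 0 := fun i => by
      have := hwt i
      simp only [c]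
      rw [← wt_mul_wt]; exact mul_ne_zero this this
    let d : ℕ → ℕ → ℂ := fun N m =>
      ∏ i ∈ Finset.range N, ((qc q ^ (2 * m) - qc q ^ (2 * (i + 1))) / c i)
    have hd : ∀ N, (fun m n => if m = n then d N m else 0 : Dist) ∈ S := by
      intro N
      have : ∃ p, ofPol q p = (fun m n => if m = n then d N m else 0 : Dist) := by
        induction N with
        | zero => exact ⟨1, by simp [ofPol, d]⟩
        | succ N ih =>
          obtain ⟨p, hp⟩ := ih
          refine ⟨(c N)⁻¹ • ((1 - z q * zs q) * p - qc q ^ (2 * (N + 1)) • p), ?_⟩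
          rw [ofPol, map_smul, map_sub, map_smul, map_mul, LinearMap.smul_apply,
            LinearMap.sub_apply, LinearMap.smul_apply, Module.End.mul_apply, lMul_y]
          change (c N)⁻¹ • ((fun m n => qc q ^ (2 * m) * ofPol q p m n)
            - qc q ^ (2 * (N + 1)) • ofPol q p) = _
          rw [hp]
          ext m n
          by_cases h : m = n
          · subst h
            simp only [Pi.smul_apply, Pi.sub_apply, if_true, smul_eq_mul, d,
              Finset.prod_range_succ]
            field_simp
          · simp [h]
      obtain ⟨p, hp⟩ := this
      rw [← hp]; exact hpol p
    refine hS.mem_of_tendsto (b := Filter.atTop) ?_ (Filter.Eventually.of_forall hd)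
    refine tendsto_pi_nhds.2 fun m => tendsto_pi_nhds.2 fun n => ?_
    refine tendsto_const_nhds.congr' ?_
    filter_upwards [Filter.eventually_ge_atTop m] with N hN
    by_cases h : m = n
    · subst h
      rcases m with _ | m
      · simp only [e, d, c, and_self, if_true, mul_zero, pow_zero]
        rw [eq_comm]
        exact Finset.prod_eq_one fun i _ => div_self (hc i)
      · simp only [e, d, if_true]
        rw [Finset.prod_eq_zero (i := m) (Finset.mem_range.2 hN) (by simp)]
        simp
    · have : ¬(m = 0 ∧ n = 0) := fun h' => h (h'.1.trans h'.2.symm)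
      simp [e, h, this]
  have hj0 : ∀ j, e j 0 ∈ S := by
    intro j
    induction j with
    | zero => exact h00
    | succ j ih =>
      have : e (j + 1) 0 = (wt q (j + 1))⁻¹ • lz q (e j 0) := by
        ext m n
        rcases m with _ | m
        · simp [e, lz, wt_zero]
        · have := hwt j
          by_cases h : m = j
          · subst h; simp [e, lz, this]
          · simp [e, lz, h]
      rw [this]; exact S.smul_mem _ (hlz _ ih)
  have hjk : ∀ j k, e j k ∈ S := by
    intro j k
    induction k with
    | zero => exact hj0 j
    | succ k ih =>
      have : e j (k + 1) = (wt q (k + 1))⁻¹ • rzs q (e j k) := by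
        ext m n
        rcases n with _ | n
        · simp [e, rzs, wt_zero]
        · have := hwt k
          by_cases h : n = k
          · subst h; simp [e, rzs, this]
          · simp [e, rzs, h]
      rw [this]; exact S.smul_mem _ (hrzs _ ih)
  have hall : ∀ f : Dist, f ∈ S := by
    intro f
    have hsum : ∀ N, (∑ j ∈ Finset.range N, ∑ k ∈ Finset.range N, f j k • e j k) ∈ S :=
      fun N => S.sum_mem fun j _ => S.sum_mem fun k _ => S.smul_mem _ (hjk j k)
    refine hS.mem_of_tendsto (b := Filter.atTop) ?_ (Filter.Eventually.of_forall hsum)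
    refine tendsto_pi_nhds.2 fun m => tendsto_pi_nhds.2 fun n => ?_
    refine tendsto_const_nhds.congr' ?_
    filter_upwards [Filter.eventually_gt_atTop m, Filter.eventually_gt_atTop n] with N h1 h2
    simp only [Finset.sum_apply, Pi.smul_apply, smul_eq_mul, e]
    rw [Finset.sum_eq_single m, Finset.sum_eq_single n]
    · simp
    · intro k _ hk; simp [hk.symm]
    · intro h; exact absurd (Finset.mem_range.2 h2) h
    · intro j _ hj; simp [hj.symm]
    · intro h; exact absurd (Finset.mem_range.2 h1) h
  intro f
  have := hall f
  have hr : (LinearMap.range L : Set Dist) = Set.range (ofPol q) := LinearMap.coe_range L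
  rw [← hr]
  exact this

end compatibility

/-! ### Forms of type (0,1)

The form `f dz*` is identified with its coefficient `f`. The action of `U_q sl₂` is the one for
which `(f, ω) ↦ f ω` is a morphism of modules, with `ξ (dz*) = ∂̄ (ξ z*)`. -/

/-- `K (f dz*) = K f · K (dz*)`. -/
def formK (q : Par) : Module.End ℂ Dist := rightMul q (polDbar q (polK q (zs q))) * distK q

/-- `K⁻¹ (f dz*) = K⁻¹ f · K⁻¹ (dz*)`. -/
def formKinv (q : Par) : Module.End ℂ Dist := rightMul q (polDbar q (polKinv q (zs q))) * distKinv q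

/-- `E (f dz*) = E f · dz* + K f · E (dz*)`. -/
def formE (q : Par) : Module.End ℂ Dist :=
  distE q + rightMul q (polDbar q (polE q (zs q))) * distK q

/-- `F (f dz*) = F f · K⁻¹ (dz*) + f · F (dz*)`. -/
def formF (q : Par) : Module.End ℂ Dist :=
  rightMul q (polDbar q (polKinv q (zs q))) * distF q + rightMul q (polDbar q (polF q (zs q)))

section forms

variable (q : Par)

theorem formK_apply (f : Dist) : formK q f = (qc q ^ 2)⁻¹ • distK q f := by
  simp [formK, polK, polDbar, rightMul_smul]

theorem formKinv_apply (f : Dist) : formKinv q f = qc q ^ 2 • distKinv q f := by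
  simp [formKinv, polKinv, polDbar, rightMul_smul]

theorem formE_apply (f : Dist) : formE q f = distE q f := by
  have : polDbar q (polE q (zs q)) = 0 := by simp only [polE, twDer_zs, polDbar, twDer_algebraMap]
  rw [formE, this]
  simp [rightMul]

theorem formF_apply (f : Dist) : formF q f =
    qc q ^ 2 • distF q f - (sq q * (qc q ^ 2 + 1)) • rzs q f := by
  have h0 := qc_ne_zero q
  have h1 : polDbar q (polF q (zs q)) = -(sq q * (qc q ^ 2 + 1)) • zs q := by
    simp only [polF, twDer_zs, map_smul, polDbar, pow_two, twDer_mul, AlgHom.id_apply, mul_one,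
      one_mul, polK, Pol.lift_zs]
    match_scalars
    field_simp
  have h2 : polDbar q (polKinv q (zs q)) = qc q ^ 2 • 1 := by simp [polKinv, polDbar]
  rw [formF, h1, h2, rightMul_smul, rightMul_smul, rightMul_one, rightMul_zs]
  simp only [LinearMap.add_apply, LinearMap.smul_apply, Module.End.mul_apply,
    Module.End.one_apply]
  module

theorem formE_formF (f : Dist) : formE q (formF q f) - formF q (formE q f) =
    (qc q - (qc q)⁻¹)⁻¹ • (formK q f - formKinv q f) := by
  have h0 := qc_ne_zero q
  have h1 := one_sub_ne_zero q
  have h2 : (qc q - (qc q)⁻¹)⁻¹ = -(qc q / (1 - qc q ^ 2)) := by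
    have h3 := q_sub_inv_ne_zero q
    rw [inv_eq_iff_eq_inv, eq_comm, ← neg_inv, inv_div]
    field_simp; ring
  have h3 := sq_mul_sq q
  rw [h2]
  simp only [formE_apply, formF_apply, formK_apply, formKinv_apply, distE_apply, distF_apply,
    map_smul, map_sub, distK_lzs, distK_rzs,
    distK_distKinv, distKinv_distK, distKinv_lz, distKinv_rz, rz_lzs, rzs_lz, rz_rzs_apply,
    lzs_lz_apply, smul_add, smul_sub, smul_smul]
  match_scalars <;> field_simp <;>
    first | ring1 | linear_combination h3 | linear_combination -h3

end forms

/-- The action of `U_q sl₂` on the (0,1)-forms with distribution coefficients. -/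
def formAct (q : Par) : Uq q →ₐ[ℂ] Module.End ℂ Dist :=
  have h0 := qc_ne_zero q
  Uq.lift q (formK q) (formKinv q) (formE q) (formF q)
    (LinearMap.ext fun f => by
      simp only [Module.End.mul_apply, Module.End.one_apply, formK_apply, formKinv_apply, map_smul,
        smul_smul, distK_distKinv]
      simp [h0])
    (LinearMap.ext fun f => by
      simp only [Module.End.mul_apply, Module.End.one_apply, formK_apply, formKinv_apply, map_smul,
        smul_smul, distKinv_distK]
      simp [h0])
    (LinearMap.ext fun f => by
      simp only [Module.End.mul_apply, LinearMap.smul_apply, formK_apply, formE_apply, map_smul,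
        distK_distE]
      module)
    (LinearMap.ext fun f => by
      simp only [Module.End.mul_apply, LinearMap.smul_apply, formKinv_apply, formE_apply, map_smul,
        distKinv_distE]
      module)
    (LinearMap.ext fun f => by
      simp only [Module.End.mul_apply, LinearMap.smul_apply, formK_apply, formF_apply, map_smul,
        map_sub, distK_distF, distK_rzs]
      module)
    (LinearMap.ext fun f => by
      simp only [Module.End.mul_apply, LinearMap.smul_apply, formKinv_apply, formF_apply, map_smul,
        map_sub, distKinv_distF, distKinv_rzs]
      module)
    (LinearMap.ext (formE_formF q))

/-! ### Finite functions -/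

/-- The finite functions: distributions with finitely many nonzero matrix elements. -/
def finSub : Submodule ℂ Dist where
  carrier := {f | ∃ N : ℕ, ∀ m n, N ≤ m ∨ N ≤ n → f m n = 0}
  zero_mem' := ⟨0, fun _ _ _ => rfl⟩
  add_mem' := by
    rintro f g ⟨N, hN⟩ ⟨M, hM⟩
    refine ⟨max N M, fun m n h => ?_⟩
    simp only [Pi.add_apply]
    rw [hN m n (by omega), hM m n (by omega), add_zero]
  smul_mem' := by
    rintro c f ⟨N, hN⟩
    exact ⟨N, fun m n h => by simp [hN m n h]⟩

theorem wt_succ_ne_zero (q : Par) (m : ℕ) : wt q (m + 1) ≠ 0 := by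
  have h : 0 < 1 - (q : ℝ) ^ (2 * (m + 1)) := by
    have := pow_lt_one₀ q.2.1.le q.2.2 (n := 2 * (m + 1)) (by omega)
    linarith
  unfold wt
  exact_mod_cast (Real.sqrt_pos.2 h).ne'

/-- The finite functions are the distributions `f` with `z*^N f = f z^N = 0` for some `N`. -/
theorem mem_finSub_iff (q : Par) (f : Dist) : f ∈ finSub ↔
    ∃ N : ℕ, lMul q (zs q ^ N) f = 0 ∧ rightMul q (z q ^ N) f = 0 := by
  have h1 : ∀ N : ℕ, lMul q (zs q ^ N) f = 0 ↔ ∀ m n, f (m + N) n = 0 := by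
    intro N
    have : ∀ m n, ∃ c : ℂ, c ≠ 0 ∧ lMul q (zs q ^ N) f m n = c * f (m + N) n := by
      rw [map_pow, lMul_zs]
      induction N with
      | zero => exact fun m n => ⟨1, one_ne_zero, by simp⟩
      | succ N ih =>
        intro m n
        obtain ⟨c, hc, h⟩ := ih (m + 1) n
        refine ⟨wt q (m + 1) * c, mul_ne_zero (wt_succ_ne_zero q m) hc, ?_⟩
        rw [pow_succ', Module.End.mul_apply, mul_assoc, add_comm N 1, ← add_assoc, ← h]
        rfl
    constructor
    · intro h m n
      obtain ⟨c, hc, e⟩ := this m n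
      rw [h] at e
      simpa [hc] using e.symm
    · intro h
      ext m n
      obtain ⟨c, hc, e⟩ := this m n
      rw [e, h, mul_zero]; rfl
  have h2 : ∀ N : ℕ, rightMul q (z q ^ N) f = 0 ↔ ∀ m n, f m (n + N) = 0 := by
    intro N
    have : ∀ m n, ∃ c : ℂ, c ≠ 0 ∧ rightMul q (z q ^ N) f m n = c * f m (n + N) := by
      have e : rightMul q (z q ^ N) = rz q ^ N := by simp [rightMul, rMul]
      rw [e]
      clear e
      induction N with
      | zero => exact fun m n => ⟨1, one_ne_zero, by simp⟩
      | succ N ih =>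
        intro m n
        obtain ⟨c, hc, h⟩ := ih m (n + 1)
        refine ⟨wt q (n + 1) * c, mul_ne_zero (wt_succ_ne_zero q n) hc, ?_⟩
        rw [pow_succ', Module.End.mul_apply, mul_assoc, add_comm N 1, ← add_assoc, ← h]
        rfl
    constructor
    · intro h m n
      obtain ⟨c, hc, e⟩ := this m n
      rw [h] at e
      simpa [hc] using e.symm
    · intro h
      ext m n
      obtain ⟨c, hc, e⟩ := this m n
      rw [e, h, mul_zero]; rfl
  simp only [h1, h2]
  constructor
  · rintro ⟨N, hN⟩
    exact ⟨N, fun m n => hN _ _ (by omega), fun m n => hN _ _ (by omega)⟩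
  · rintro ⟨N, h3, h4⟩
    refine ⟨N, ?_⟩
    rintro m n (h | h)
    · have := h3 (m - N) n
      rwa [Nat.sub_add_cancel h] at this
    · have := h4 m (n - N)
      rwa [Nat.sub_add_cancel h] at this

section finite

variable (q : Par)

theorem lz_mem {f : Dist} (h : f ∈ finSub) : lz q f ∈ finSub := by
  obtain ⟨N, hN⟩ := h
  exact ⟨N + 1, fun m n h => by simp [lz, hN (m - 1) n (by omega)]⟩

theorem lzs_mem {f : Dist} (h : f ∈ finSub) : lzs q f ∈ finSub := by
  obtain ⟨N, hN⟩ := h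
  exact ⟨N, fun m n h => by simp [lzs, hN (m + 1) n (by omega)]⟩

theorem rz_mem {f : Dist} (h : f ∈ finSub) : rz q f ∈ finSub := by
  obtain ⟨N, hN⟩ := h
  exact ⟨N, fun m n h => by simp [rz, hN m (n + 1) (by omega)]⟩

theorem rzs_mem {f : Dist} (h : f ∈ finSub) : rzs q f ∈ finSub := by
  obtain ⟨N, hN⟩ := h
  exact ⟨N + 1, fun m n h => by simp [rzs, hN m (n - 1) (by omega)]⟩

theorem diagOp_mem (a : ℕ → ℕ → ℂ) {f : Dist} (h : f ∈ finSub) : diagOp a f ∈ finSub := by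
  obtain ⟨N, hN⟩ := h
  exact ⟨N, fun m n h => by simp [diagOp, hN m n h]⟩

theorem distE_mem {f : Dist} (h : f ∈ finSub) : distE q f ∈ finSub := by
  rw [distE_apply]
  exact finSub.smul_mem _ (finSub.sub_mem (lz_mem q h) (rz_mem q (diagOp_mem _ h)))

theorem distF_mem {f : Dist} (h : f ∈ finSub) : distF q f ∈ finSub := by
  rw [distF_apply]
  exact finSub.smul_mem _ (finSub.sub_mem (lzs_mem q (diagOp_mem _ h)) (rzs_mem q h))

theorem distDbar_mem {f : Dist} (h : f ∈ finSub) : distDbar q f ∈ finSub :=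
  diagOp_mem _ (finSub.sub_mem (rz_mem q h) (lz_mem q h))

theorem distAct_mem (ξ : Uq q) {f : Dist} (h : f ∈ finSub) : distAct q ξ f ∈ finSub := by
  induction ξ using Uq.induction generalizing f with
  | hs c => rw [AlgHom.commutes, Module.algebraMap_end_apply]; exact finSub.smul_mem _ h
  | hg g =>
    rw [distAct, Uq.lift_gen]
    cases g
    · exact diagOp_mem _ h
    · exact diagOp_mem _ h
    · exact distE_mem q h
    · exact distF_mem q h
  | hm a b ha hb => rw [map_mul]; exact ha (hb h)
  | ha a b ha hb => rw [map_add]; exact finSub.add_mem (ha h) (hb h)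

theorem formAct_mem (ξ : Uq q) {f : Dist} (h : f ∈ finSub) : formAct q ξ f ∈ finSub := by
  induction ξ using Uq.induction generalizing f with
  | hs c => rw [AlgHom.commutes, Module.algebraMap_end_apply]; exact finSub.smul_mem _ h
  | hg g =>
    rw [formAct, Uq.lift_gen]
    cases g
    · change formK q f ∈ _
      rw [formK_apply]; exact finSub.smul_mem _ (diagOp_mem _ h)
    · change formKinv q f ∈ _
      rw [formKinv_apply]; exact finSub.smul_mem _ (diagOp_mem _ h)
    · change formE q f ∈ _
      rw [formE_apply]; exact distE_mem q h
    · change formF q f ∈ _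
      rw [formF_apply]
      exact finSub.sub_mem (finSub.smul_mem _ (distF_mem q h)) (finSub.smul_mem _ (rzs_mem q h))
  | hm a b ha hb => rw [map_mul]; exact ha (hb h)
  | ha a b ha hb => rw [map_add]; exact finSub.add_mem (ha h) (hb h)

end finite

/-- The restriction of an action on distributions to the finite functions. -/
def restrictAct (q : Par) (φ : Uq q →ₐ[ℂ] Module.End ℂ Dist)
    (h : ∀ ξ, ∀ f ∈ finSub, φ ξ f ∈ finSub) : Uq q →+* Module.End ℂ finSub where
  toFun ξ := (φ ξ).restrict (h ξ)
  map_one' := by ext f : 2; simp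
  map_mul' a b := by ext f : 2; simp
  map_zero' := by ext f : 2; simp
  map_add' a b := by ext f : 2; simp

/-- The space `D(U)_q` of finite functions in the quantum disc. -/
def DU (_q : Par) : Type := finSub

/-- The space `Ω(U)_q^{(0,1)}` of the forms `f dz*` with `f` a finite function; the form `f dz*` is
represented by `f`. -/
def Omega01 (_q : Par) : Type := finSub

section spaces

variable (q : Par)

instance : AddCommGroup (DU q) := inferInstanceAs (AddCommGroup finSub)

instance : Module ℂ (DU q) := inferInstanceAs (Module ℂ finSub)

instance : AddCommGroup (Omega01 q) := inferInstanceAs (AddCommGroup finSub)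

instance : Module ℂ (Omega01 q) := inferInstanceAs (Module ℂ finSub)

/-- A finite function as a distribution. -/
def DU.toDist : DU q →ₗ[ℂ] Dist := finSub.subtype

/-- The coefficient `f` of the form `f dz*`. -/
def Omega01.coeff : Omega01 q →ₗ[ℂ] Dist := finSub.subtype

/-- `D(U)_q` as a module over `U_q sl₂`. -/
instance : Module (Uq q) (DU q) :=
  Module.compHom finSub (restrictAct q (distAct q) fun ξ _ h => distAct_mem q ξ h)

/-- `Ω(U)_q^{(0,1)}` as a module over `U_q sl₂`. -/
instance : Module (Uq q) (Omega01 q) :=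
  Module.compHom finSub (restrictAct q (formAct q) fun ξ _ h => formAct_mem q ξ h)

theorem DU.toDist_smul (ξ : Uq q) (f : DU q) :
    DU.toDist q (ξ • f) = distAct q ξ (DU.toDist q f) := rfl

theorem Omega01.coeff_smul (ξ : Uq q) (ω : Omega01 q) :
    Omega01.coeff q (ξ • ω) = formAct q ξ (Omega01.coeff q ω) := rfl

/-- The operator `∂̄ : D(U)_q → Ω(U)_q^{(0,1)}`. -/
def dbar : DU q →ₗ[ℂ] Omega01 q :=
  (distDbar q).restrict (p := finSub) (q := finSub) fun _ h => distDbar_mem q h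

theorem coeff_dbar (f : DU q) : Omega01.coeff q (dbar q f) = distDbar q (DU.toDist q f) := rfl

end spaces

/-! ### The scalar products -/

/-- The product of finite functions, as the product of matrices. -/
def mulF (f g : Dist) : Dist := fun m n => ∑ᶠ k, f m k * g k n

/-- The involution `f ↦ f*`. -/
def starF (f : Dist) : Dist := fun m n => conj (f n m)

/-- The invariant integral `∫ f dν = (1 - q²) ∑ ψ₀(q^{2m}) q^{-2m}` of a finite function
`f = ∑_{j>0} z^j ψ_j(y) + ψ₀(y) + ∑_{j>0} ψ_{-j}(y) z*^j`, `y = 1 - z z*`. Since `y e_m = q^{2m} e_m`,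
`ψ₀(q^{2m})` is the diagonal matrix element of `f` at `e_m`. -/
def integral (q : Par) (f : Dist) : ℂ :=
  (1 - qc q ^ 2) * ∑ᶠ m, f m m * (qc q ^ (2 * m))⁻¹

/-- The scalar product `∫ f* g dν`. -/
def innerNu (q : Par) (f g : Dist) : ℂ := integral q (mulF (starF f) g)

/-- The scalar product `∫ f* g (1 - z z*)² dν` of the forms `f dz*` and `g dz*`. -/
def innerMu (q : Par) (f g : Dist) : ℂ :=
  integral q (rightMul q ((1 - z q * zs q) ^ 2) (mulF (starF f) g))

/-- The finite-dimensional expression of the scalar products. -/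
def gram (a : ℕ → ℝ) (N : ℕ) (f g : Dist) : ℂ :=
  ∑ n ∈ Finset.range N, ∑ m ∈ Finset.range N, (a n : ℂ) * (conj (f m n) * g m n)

def wNu (q : Par) (n : ℕ) : ℝ := (1 - (q : ℝ) ^ 2) * ((q : ℝ) ^ (2 * n))⁻¹

def wMu (q : Par) (n : ℕ) : ℝ := (1 - (q : ℝ) ^ 2) * (q : ℝ) ^ (2 * n)

/-- `f` is supported in the block of size `N`. -/
def Bdd (N : ℕ) (f : Dist) : Prop := ∀ m n, N ≤ m ∨ N ≤ n → f m n = 0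

theorem Bdd.mono {N M : ℕ} {f : Dist} (h : Bdd N f) (hNM : N ≤ M) : Bdd M f :=
  fun m n h' => h m n (by omega)

theorem wNu_pos (q : Par) (n : ℕ) : 0 < wNu q n :=
  mul_pos (one_sub_pos q) (inv_pos.2 (pow_pos q.2.1 _))

theorem wMu_pos (q : Par) (n : ℕ) : 0 < wMu q n :=
  mul_pos (one_sub_pos q) (pow_pos q.2.1 _)

theorem mulF_star_apply {N : ℕ} {f g : Dist} (hf : Bdd N f) (m n : ℕ) :
    mulF (starF f) g m n = ∑ k ∈ Finset.range N, conj (f k m) * g k n := by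
  refine finsum_eq_sum_of_support_subset _ fun k hk => ?_
  by_contra h
  have : N ≤ k := by simpa using h
  exact hk (by simp [starF, hf k m (Or.inl this)])

theorem innerNu_eq (q : Par) {N : ℕ} {f g : Dist} (hf : Bdd N f) :
    innerNu q f g = gram (wNu q) N f g := by
  rw [innerNu, integral, finsum_eq_sum_of_support_subset (s := Finset.range N), gram,
    Finset.mul_sum]
  · refine Finset.sum_congr rfl fun n _ => ?_
    rw [mulF_star_apply hf, Finset.sum_mul, Finset.mul_sum]
    refine Finset.sum_congr rfl fun m _ => ?_
    simp only [wNu, qc]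
    push_cast
    ring
  · intro n hn
    by_contra h
    have : N ≤ n := by simpa using h
    refine hn ?_
    simp only [mulF_star_apply hf]
    rw [Finset.sum_eq_zero, zero_mul]
    intro k _
    rw [hf k n (Or.inr this)]; simp

theorem rightMul_y_sq (q : Par) (f : Dist) :
    rightMul q ((1 - z q * zs q) ^ 2) f = fun m n => qc q ^ (4 * n) * f m n := by
  have h : ∀ f, rightMul q (1 - z q * zs q) f = fun m n => qc q ^ (2 * n) * f m n := by
    intro f
    rw [rightMul_sub, rightMul_one, rightMul_mul, rightMul_z, rightMul_zs]
    ext m n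
    have e1 := wt_mul_wt q n
    rcases n with _ | n
    · simp [rzs, wt_zero]
    · simp only [LinearMap.sub_apply, Module.End.mul_apply, Module.End.one_apply, rz, rzs,
        LinearMap.coe_mk, AddHom.coe_mk, Pi.sub_apply, Nat.add_sub_cancel]
      linear_combination -(f m (n + 1)) * e1
  rw [pow_two, rightMul_mul, Module.End.mul_apply, h, h]
  ext m n
  ring

theorem innerMu_eq (q : Par) {N : ℕ} {f g : Dist} (hf : Bdd N f) :
    innerMu q f g = gram (wMu q) N f g := by
  have h0 := qc_ne_zero q
  rw [innerMu, rightMul_y_sq, integral, finsum_eq_sum_of_support_subset (s := Finset.range N),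
    gram, Finset.mul_sum]
  · refine Finset.sum_congr rfl fun n _ => ?_
    rw [mulF_star_apply hf, Finset.mul_sum, Finset.sum_mul, Finset.mul_sum]
    refine Finset.sum_congr rfl fun m _ => ?_
    have : qc q ^ (4 * n) = qc q ^ (2 * n) * qc q ^ (2 * n) := by rw [← pow_add]; ring_nf
    rw [this]
    have h2 : ((wMu q n : ℝ) : ℂ) = (1 - qc q ^ 2) * qc q ^ (2 * n) := by
      simp only [wMu, qc]; push_cast; ring
    rw [h2]
    field_simp
  · intro n hn
    by_contra h
    have : N ≤ n := by simpa using h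
    refine hn ?_
    simp only [mulF_star_apply hf]
    rw [Finset.sum_eq_zero, mul_zero, zero_mul]
    intro k _
    rw [hf k n (Or.inr this)]; simp

theorem exists_bdd (f : finSub) : ∃ N, Bdd N f.1 := f.2

theorem gram_self (a : ℕ → ℝ) (N : ℕ) (f : Dist) :
    gram a N f f = ((∑ n ∈ Finset.range N, ∑ m ∈ Finset.range N, a n * ‖f m n‖ ^ 2 : ℝ) : ℂ) := by
  rw [gram]
  push_cast
  refine Finset.sum_congr rfl fun n _ => Finset.sum_congr rfl fun m _ => ?_
  rw [Complex.conj_mul']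

/-- A scalar product on finite functions given by positive weights. -/
@[reducible] def gramCore (a : ℕ → ℝ) (ha : ∀ n, 0 < a n) (i : Dist → Dist → ℂ)
    (hi : ∀ N f g, Bdd N f → i f g = gram a N f g) : InnerProductSpace.Core ℂ finSub where
  inner f g := i f.1 g.1
  conj_inner_symm f g := by
    obtain ⟨N, hN⟩ := exists_bdd f
    obtain ⟨M, hM⟩ := exists_bdd g
    rw [hi _ _ _ (hN.mono (le_max_left N M)), hi _ _ _ (hM.mono (le_max_right N M)), gram, gram]
    simp only [map_sum, map_mul, Complex.conj_ofReal, Complex.conj_conj]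
    refine Finset.sum_congr rfl fun n _ => Finset.sum_congr rfl fun m _ => ?_
    ring
  re_inner_nonneg f := by
    obtain ⟨N, hN⟩ := exists_bdd f
    rw [hi _ _ _ hN, gram_self]
    simp only [Complex.ofReal_re, RCLike.re_to_complex]
    exact Finset.sum_nonneg fun n _ => Finset.sum_nonneg fun m _ =>
      mul_nonneg (ha n).le (sq_nonneg _)
  add_left f g h := by
    obtain ⟨N, hN⟩ := exists_bdd f
    obtain ⟨M, hM⟩ := exists_bdd g
    have h1 := hN.mono (le_max_left N M)
    have h2 := hM.mono (le_max_right N M)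
    have h3 : Bdd (max N M) (f + g).1 := fun m n h' => by
      change f.1 m n + g.1 m n = 0
      rw [h1 m n h', h2 m n h', add_zero]
    rw [hi _ _ _ h1, hi _ _ _ h2, hi _ _ _ h3]
    simp only [gram, ← Finset.sum_add_distrib]
    refine Finset.sum_congr rfl fun n _ => Finset.sum_congr rfl fun m _ => ?_
    change _ * (conj (f.1 m n + g.1 m n) * _) = _
    rw [map_add]; ring
  smul_left f g c := by
    obtain ⟨N, hN⟩ := exists_bdd f
    have h3 : Bdd N (c • f).1 := fun m n h' => by
      change c * f.1 m n = 0
      rw [hN m n h', mul_zero]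
    rw [hi _ _ _ hN, hi _ _ _ h3]
    simp only [gram, Finset.mul_sum]
    refine Finset.sum_congr rfl fun n _ => Finset.sum_congr rfl fun m _ => ?_
    change _ * (conj (c * f.1 m n) * _) = _
    rw [map_mul]; ring
  definite f h := by
    obtain ⟨N, hN⟩ := exists_bdd f
    rw [hi _ _ _ hN, gram_self] at h
    have h1 := Complex.ofReal_eq_zero.1 h
    rw [Finset.sum_eq_zero_iff_of_nonneg fun n _ => Finset.sum_nonneg fun m _ =>
      mul_nonneg (ha n).le (sq_nonneg _)] at h1
    apply Subtype.ext
    ext m n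
    by_cases hmn : N ≤ m ∨ N ≤ n
    · exact hN m n hmn
    · push Not at hmn
      have h2 := h1 n (Finset.mem_range.2 hmn.2)
      rw [Finset.sum_eq_zero_iff_of_nonneg fun m _ => mul_nonneg (ha n).le (sq_nonneg _)] at h2
      have h3 := h2 m (Finset.mem_range.2 hmn.1)
      have h4 : ‖f.1 m n‖ ^ 2 = 0 := (mul_eq_zero.1 h3).resolve_left (ha n).ne'
      exact norm_eq_zero.1 (pow_eq_zero_iff two_ne_zero |>.1 h4)

section hilbert

variable (q : Par)

@[reducible] def coreNu : InnerProductSpace.Core ℂ (DU q) :=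
  gramCore (wNu q) (wNu_pos q) (innerNu q) fun _ _ _ h => innerNu_eq q h

@[reducible] def coreMu : InnerProductSpace.Core ℂ (Omega01 q) :=
  gramCore (wMu q) (wMu_pos q) (innerMu q) fun _ _ _ h => innerMu_eq q h

instance : NormedAddCommGroup (DU q) := (coreNu q).toNormedAddCommGroup

instance : InnerProductSpace ℂ (DU q) := InnerProductSpace.ofCore (coreNu q).toCore

instance : NormedAddCommGroup (Omega01 q) := (coreMu q).toNormedAddCommGroup

instance : InnerProductSpace ℂ (Omega01 q) := InnerProductSpace.ofCore (coreMu q).toCore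

theorem inner_DU (f g : DU q) :
    @inner ℂ (DU q) InnerProductSpace.toInner f g = innerNu q (DU.toDist q f) (DU.toDist q g) := rfl

theorem inner_Omega01 (f g : Omega01 q) :
    @inner ℂ (Omega01 q) InnerProductSpace.toInner f g = innerMu q (Omega01.coeff q f) (Omega01.coeff q g) := rfl

/-- The Hilbert space `L²(dν)_q`, the completion of `D(U)_q`. -/
abbrev L2Nu := UniformSpace.Completion (DU q)

/-- The Hilbert space `L²(dμ)_q`, the completion of `Ω(U)_q^{(0,1)}`. -/
abbrev L2Mu := UniformSpace.Completion (Omega01 q)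

/-- The inclusion of `D(U)_q` in `L²(dν)_q`. -/
def iNu : DU q →ₗ[ℂ] L2Nu q := (UniformSpace.Completion.toComplL (𝕜 := ℂ) (E := DU q)).toLinearMap

/-- The inclusion of `Ω(U)_q^{(0,1)}` in `L²(dμ)_q`. -/
def iMu : Omega01 q →ₗ[ℂ] L2Mu q :=
  (UniformSpace.Completion.toComplL (𝕜 := ℂ) (E := Omega01 q)).toLinearMap

theorem norm_sq_DU {N : ℕ} (f : DU q) (h : Bdd N (DU.toDist q f)) : ‖f‖ ^ 2 =
    ∑ n ∈ Finset.range N, ∑ m ∈ Finset.range N, wNu q n * ‖DU.toDist q f m n‖ ^ 2 := by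
  rw [norm_sq_eq_re_inner (𝕜 := ℂ), inner_DU, innerNu_eq q h, gram_self]
  exact Complex.ofReal_re _

theorem norm_sq_Omega01 {N : ℕ} (f : Omega01 q) (h : Bdd N (Omega01.coeff q f)) : ‖f‖ ^ 2 =
    ∑ n ∈ Finset.range N, ∑ m ∈ Finset.range N, wMu q n * ‖Omega01.coeff q f m n‖ ^ 2 := by
  rw [norm_sq_eq_re_inner (𝕜 := ℂ), inner_Omega01, innerMu_eq q h, gram_self]
  exact Complex.ofReal_re _

theorem norm_wt_le (m : ℕ) : ‖wt q m‖ ≤ 1 := by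
  have h : (0 : ℝ) ≤ (q : ℝ) ^ (2 * m) := pow_nonneg q.2.1.le _
  rw [wt, Complex.norm_real, Real.norm_of_nonneg (Real.sqrt_nonneg _)]
  exact Real.sqrt_le_one.2 (by linarith)

theorem norm_distDbar_le (f : Dist) (m n : ℕ) :
    wMu q n * ‖distDbar q f m n‖ ^ 2 ≤ 2 / (1 - (q : ℝ) ^ 2) ^ 2 *
      (wNu q (n + 1) * ‖f m (n + 1)‖ ^ 2
        + if m = 0 then 0 else wNu q n * ‖f (m - 1) n‖ ^ 2) := by
  have hq := one_sub_pos q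
  have hp : 0 < (q : ℝ) ^ (2 * n) := pow_pos q.2.1 _
  set u : ℂ := wt q (n + 1) * f m (n + 1) with hu
  set v : ℂ := wt q m * f (m - 1) n with hv
  have e : distDbar q f m n = ((1 - qc q ^ 2) * qc q ^ (2 * n))⁻¹ * (u - v) := rfl
  have hn : ‖((1 - qc q ^ 2) * qc q ^ (2 * n))⁻¹‖ = ((1 - (q : ℝ) ^ 2) * (q : ℝ) ^ (2 * n))⁻¹ := by
    have : ((1 - qc q ^ 2) * qc q ^ (2 * n))⁻¹ =
        ((((1 - (q : ℝ) ^ 2) * (q : ℝ) ^ (2 * n))⁻¹ : ℝ) : ℂ) := by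
      simp only [qc]; push_cast; rfl
    rw [this, Complex.norm_real, Real.norm_of_nonneg (inv_nonneg.2 (mul_pos hq hp).le)]
  have h1 : ‖u‖ ^ 2 ≤ ‖f m (n + 1)‖ ^ 2 := by
    rw [hu, norm_mul, mul_pow]
    exact mul_le_of_le_one_left (sq_nonneg _) (pow_le_one₀ (norm_nonneg _) (norm_wt_le q _))
  have h2 : ‖v‖ ^ 2 ≤ if m = 0 then 0 else ‖f (m - 1) n‖ ^ 2 := by
    split_ifs with h
    · rw [hv, h, wt_zero]; simp
    · rw [hv, norm_mul, mul_pow]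
      exact mul_le_of_le_one_left (sq_nonneg _) (pow_le_one₀ (norm_nonneg _) (norm_wt_le q _))
  have h3 : ‖u - v‖ ^ 2 ≤ 2 * (‖u‖ ^ 2 + ‖v‖ ^ 2) := by
    have := norm_sub_le u v
    have h4 : ‖u - v‖ ^ 2 ≤ (‖u‖ + ‖v‖) ^ 2 := pow_le_pow_left₀ (norm_nonneg _) this 2
    nlinarith [sq_nonneg (‖u‖ - ‖v‖)]
  have h5 : wNu q n ≤ wNu q (n + 1) := by
    refine mul_le_mul_of_nonneg_left ?_ hq.le
    exact inv_anti₀ (pow_pos q.2.1 _) (pow_le_pow_of_le_one q.2.1.le q.2.2.le (by omega))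
  have h6 : wMu q n * ‖distDbar q f m n‖ ^ 2 =
      1 / (1 - (q : ℝ) ^ 2) ^ 2 * (wNu q n * ‖u - v‖ ^ 2) := by
    rw [e, norm_mul, hn, wMu, wNu]
    field_simp
  have h7 : wNu q n * ‖u - v‖ ^ 2 ≤ 2 * (wNu q (n + 1) * ‖f m (n + 1)‖ ^ 2
        + if m = 0 then 0 else wNu q n * ‖f (m - 1) n‖ ^ 2) := by
    have h8 := wNu_pos q n
    have h9 : wNu q n * ‖u‖ ^ 2 ≤ wNu q (n + 1) * ‖f m (n + 1)‖ ^ 2 :=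
      mul_le_mul h5 h1 (sq_nonneg _) (wNu_pos q _).le
    have h10 : wNu q n * ‖v‖ ^ 2 ≤ if m = 0 then 0 else wNu q n * ‖f (m - 1) n‖ ^ 2 := by
      have := mul_le_mul_of_nonneg_left h2 h8.le
      rwa [mul_ite, mul_zero] at this
    have := mul_le_mul_of_nonneg_left h3 h8.le
    linarith
  rw [h6]
  calc _ ≤ 1 / (1 - (q : ℝ) ^ 2) ^ 2 * _ := mul_le_mul_of_nonneg_left h7 (by positivity)
    _ = _ := by ring

theorem norm_dbar_le : ∃ C : ℝ, ∀ f : DU q, ‖iMu q (dbar q f)‖ ≤ C * ‖iNu q f‖ := by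
  set c : ℝ := 2 / (1 - (q : ℝ) ^ 2) ^ 2
  have hc : 0 ≤ c := by positivity
  refine ⟨Real.sqrt (c * 2), fun f => ?_⟩
  have e1 : ‖iMu q (dbar q f)‖ = ‖dbar q f‖ := UniformSpace.Completion.norm_coe _
  have e2 : ‖iNu q f‖ = ‖f‖ := UniformSpace.Completion.norm_coe _
  rw [e1, e2]
  obtain ⟨N, hN⟩ := exists_bdd f
  have hf : Bdd (N + 2) (DU.toDist q f) := Bdd.mono (f := f.1) hN (by omega)
  have hg : Bdd (N + 1) (Omega01.coeff q (dbar q f)) := by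
    intro m n h
    rw [coeff_dbar]
    have h1 : DU.toDist q f m (n + 1) = 0 := hN _ _ (by omega)
    have h2 : DU.toDist q f (m - 1) n = 0 := hN _ _ (by omega)
    simp [distDbar, diagOp, rz, lz, h1, h2]
  have key : ‖dbar q f‖ ^ 2 ≤ c * 2 * ‖f‖ ^ 2 := by
    rw [norm_sq_DU q f hf, norm_sq_Omega01 q _ hg, coeff_dbar]
    set F := DU.toDist q f
    have hpos : ∀ m n, 0 ≤ wNu q n * ‖F m n‖ ^ 2 := fun m n =>
      mul_nonneg (wNu_pos q n).le (sq_nonneg _)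
    set T := ∑ n ∈ Finset.range (N + 2), ∑ m ∈ Finset.range (N + 2), wNu q n * ‖F m n‖ ^ 2
    have s1 : ∑ n ∈ Finset.range (N + 1), ∑ m ∈ Finset.range (N + 1),
        wNu q (n + 1) * ‖F m (n + 1)‖ ^ 2 ≤ T := by
      simp only [T]
      rw [Finset.sum_range_succ' _ (N + 1)]
      refine le_add_of_le_of_nonneg (Finset.sum_le_sum fun n _ => ?_)
        (Finset.sum_nonneg fun m _ => hpos m 0)
      exact Finset.sum_le_sum_of_subset_of_nonneg (Finset.range_mono (by omega))
        fun m _ _ => hpos m (n + 1)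
    have s2 : ∑ n ∈ Finset.range (N + 1), ∑ m ∈ Finset.range (N + 1),
        (if m = 0 then 0 else wNu q n * ‖F (m - 1) n‖ ^ 2) ≤ T := by
      refine (Finset.sum_le_sum fun n _ => ?_).trans
        (Finset.sum_le_sum_of_subset_of_nonneg (Finset.range_mono (by omega : N + 1 ≤ N + 2))
          fun n _ _ => Finset.sum_nonneg fun m _ => hpos m n)
      rw [Finset.sum_range_succ']
      simp only [Nat.add_sub_cancel, if_true, add_zero, Nat.succ_ne_zero, if_false]
      exact Finset.sum_le_sum_of_subset_of_nonneg (Finset.range_mono (by omega))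
        fun m _ _ => hpos m n
    calc _ ≤ ∑ n ∈ Finset.range (N + 1), ∑ m ∈ Finset.range (N + 1),
          c * (wNu q (n + 1) * ‖F m (n + 1)‖ ^ 2
            + if m = 0 then 0 else wNu q n * ‖F (m - 1) n‖ ^ 2) :=
          Finset.sum_le_sum fun n _ => Finset.sum_le_sum fun m _ => norm_distDbar_le q F m n
      _ = c * (∑ n ∈ Finset.range (N + 1), ∑ m ∈ Finset.range (N + 1),
          wNu q (n + 1) * ‖F m (n + 1)‖ ^ 2 + ∑ n ∈ Finset.range (N + 1),
          ∑ m ∈ Finset.range (N + 1), if m = 0 then 0 else wNu q n * ‖F (m - 1) n‖ ^ 2) := by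
          simp only [← Finset.sum_add_distrib, Finset.mul_sum]
      _ ≤ c * (T + T) := mul_le_mul_of_nonneg_left (add_le_add s1 s2) hc
      _ = _ := by ring
  refine (sq_le_sq₀ (norm_nonneg _) (mul_nonneg (Real.sqrt_nonneg _) (norm_nonneg _))).1 ?_
  rw [mul_pow, Real.sq_sqrt (by positivity)]
  exact key

/-- The bounded operator `∂̄ : L²(dν)_q → L²(dμ)_q`, the continuous extension of
`∂̄ : D(U)_q → Ω(U)_q^{(0,1)}`. -/
def dbarL2 : L2Nu q →L[ℂ] L2Mu q := ((iMu q).comp (dbar q)).extendOfNorm (iNu q)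

theorem denseRange_iNu : DenseRange (iNu q) := UniformSpace.Completion.denseRange_coe

theorem dbarL2_iNu (f : DU q) : dbarL2 q (iNu q f) = iMu q (dbar q f) :=
  LinearMap.extendOfNorm_eq (denseRange_iNu q) (norm_dbar_le q) f

/-- The adjoint operator `∂̄* : L²(dμ)_q → L²(dν)_q`. -/
def dbarStar : L2Mu q →L[ℂ] L2Nu q := ContinuousLinearMap.adjoint (dbarL2 q)

/-- The Laplace–Beltrami operator `□ = -∂̄* ∂̄` in `L²(dν)_q`. -/
def box : L2Nu q →L[ℂ] L2Nu q := -(dbarStar q ∘L dbarL2 q)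

end hilbert

end QDisc

end

open scoped ComplexConjugate

noncomputable section

namespace QDisc

variable (q : Par)

/-! The adjoint can be written down explicitly on finite forms. Put y = 1 - z z*. On coefficients,
∂̄ f = (1 - q²)⁻¹ (f z - z f) y⁻¹, and right multiplication by y multiplies column n by q^{2n}. The
weights of the two scalar products in column n are (1 - q²) q^{-2n} for ν and (1 - q²) q^{2n} for μ.
The second cancels the denominator of ∂̄, so (∂̄ f, g) becomes the unweighted Hilbert–Schmidt
pairing of f z - z f with g. There the adjoint of f ↦ f z - z f is g ↦ g z* - z* g, and restoring
the ν-weight puts a factor y on the right. This gives `distDbarStar`, which visibly preserves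
finiteness. The adjunction on finite matrices is `gram_distDbar`, a summation by parts whose lower
boundary terms vanish because z* e_0 = 0. Density and the boundedness of ∂̄ turn it into the
statement `dbarStar_iMu` about the Hilbert space adjoint.

Equivariance is then an identity between explicit operators on all matrices, to be checked on the
generators K, K⁻¹, E, F; no invariance of the scalar products is needed. Let L, R, L*, R* be the
left and right multiplications by z and z*. Left ones commute with right ones, K rescales all four,
and E, F are combinations of L - R K and L* K⁻¹ - R*. Since ∂̄ involves only L and R, it intertwines
K, K⁻¹ and E by these rules together with the exchange of y with R; likewise ∂̄* involves only L*
and R*, and K, K⁻¹, F are formal. The two remaining cases, ∂̄ with F and ∂̄* with E, mix z and z*.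
They rest on K(f) y = y f, that is, K is conjugation by y, combined with (1 - q²) y = z* z - z z*
(`rzs_rz_distK`, `rzs_rz_eq_distKinv`).

The Laplacian needs nothing more: -∂̄* ∂̄ is a composition of two module morphisms,
`distDbar_distAct` and `distDbarStar_formAct`. -/

/-- Right multiplication `f ↦ f (1 - z z*)`. -/
def ry : Module.End ℂ Dist := diagOp fun _ n => qc q ^ (2 * n)

/-- `g ↦ (1 - q²)⁻¹ (g z* - z* g) (1 - z z*)`, the formal adjoint of `distDbar`. -/
def distDbarStar : Module.End ℂ Dist := (1 - qc q ^ 2)⁻¹ • (ry q * (rzs q - lzs q))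

theorem distDbarStar_apply (g : Dist) :
    distDbarStar q g = (1 - qc q ^ 2)⁻¹ • (ry q (rzs q g) - ry q (lzs q g)) := by
  simp [distDbarStar]

/-- The entries of y are nonzero. Identities for ∂̄ may therefore be checked after right
multiplication by y, which removes the y⁻¹ from its formula. -/
theorem ry_injective : Function.Injective (ry q) := fun f g h => by
  ext m n
  exact mul_left_cancel₀ (pow_ne_zero (2 * n) (qc_ne_zero q)) (congrFun (congrFun h m) n)

theorem ry_distDbar (f : Dist) :
    ry q (distDbar q f) = (1 - qc q ^ 2)⁻¹ • (rz q f - lz q f) := by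
  have h0 := qc_ne_zero q
  have h1 := one_sub_ne_zero q
  ext m n
  simp only [ry, distDbar, diagOp, Module.End.mul_apply, LinearMap.coe_mk, AddHom.coe_mk,
    LinearMap.sub_apply, Pi.smul_apply, smul_eq_mul]
  field_simp

/-! ### Exchange relations for y, z, z* and K -/

theorem ry_lz (f : Dist) : ry q (lz q f) = lz q (ry q f) := by
  ext m n; simp [ry, diagOp, lz]; ring

theorem ry_lzs (f : Dist) : ry q (lzs q f) = lzs q (ry q f) := by
  ext m n; simp [ry, diagOp, lzs]; ring

theorem ry_distK (f : Dist) : ry q (distK q f) = distK q (ry q f) := by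
  ext m n; simp [ry, distK, diagOp]; ring

theorem ry_distKinv (f : Dist) : ry q (distKinv q f) = distKinv q (ry q f) := by
  ext m n; simp [ry, distKinv, diagOp]; ring

/-- This is z y = q⁻² y z: z raises the index by one, and y has eigenvalue q^{2n} at e_n. -/
theorem ry_rz (f : Dist) : ry q (rz q f) = (qc q ^ 2)⁻¹ • rz q (ry q f) := by
  have h0 := qc_ne_zero q
  ext m n
  simp only [ry, diagOp, rz, LinearMap.coe_mk, AddHom.coe_mk, Pi.smul_apply, smul_eq_mul]
  rw [mul_add, pow_add]
  field_simp

theorem ry_rzs (f : Dist) : ry q (rzs q f) = qc q ^ 2 • rzs q (ry q f) := by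
  ext m n
  simp only [ry, diagOp, rzs, LinearMap.coe_mk, AddHom.coe_mk, Pi.smul_apply, smul_eq_mul]
  rcases n with _ | n
  · simp [wt_zero]
  · rw [mul_add, pow_add, Nat.add_sub_cancel]
    ring

/-- The relation `K(f) y = y f`, where `(1 - q²) y = z* z - z z*`. -/
theorem ry_distK_eq (f : Dist) :
    (1 - qc q ^ 2) • ry q (distK q f) = lzs q (lz q f) - lz q (lzs q f) := by
  have h0 := qc_ne_zero q
  ext m n
  -- K multiplies the entry (m, n) by the ratio of the eigenvalues of y at m and n, so it is
  -- conjugation by y.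
  have e : qc q ^ (2 * n) * qc q ^ (2 * (m : ℤ) - 2 * (n : ℤ)) = qc q ^ (2 * m) := by
    rw [← zpow_natCast, ← zpow_natCast, ← zpow_add₀ h0]
    congr 1; push_cast; ring
  have e1 := wt_mul_wt q (m + 1)
  have e2 := wt_mul_wt q m
  simp only [ry, distK, diagOp, lz, lzs, LinearMap.coe_mk, AddHom.coe_mk, Pi.smul_apply,
    Pi.sub_apply, smul_eq_mul, Nat.add_sub_cancel]
  -- In row 0 the truncated index 0 - 1 is harmless, since it comes with the weight `wt q 0 = 0`. In
  -- the other rows the difference of consecutive squared weights is (1 - q²) q^{2m}.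
  rcases m with _ | m
  · simp only [wt_zero]
    linear_combination (1 - qc q ^ 2) * f 0 n * e - f 0 n * e1
  · simp only [Nat.add_sub_cancel]
    linear_combination (1 - qc q ^ 2) * f (m + 1) n * e - f (m + 1) n * (e1 - e2)

theorem ry_eq (f : Dist) : (1 - qc q ^ 2) • ry q f = rz q (rzs q f) - rzs q (rz q f) := by
  ext m n
  have e1 := wt_mul_wt q (n + 1)
  have e2 := wt_mul_wt q n
  simp only [ry, diagOp, rz, rzs, LinearMap.coe_mk, AddHom.coe_mk, Pi.smul_apply,
    Pi.sub_apply, smul_eq_mul, Nat.add_sub_cancel]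
  rcases n with _ | n
  · simp only [wt_zero]
    linear_combination - f m 0 * e1
  · simp only [Nat.add_sub_cancel]
    linear_combination - f m (n + 1) * (e1 - e2)

/-- K(f) y = y f with y eliminated on both sides through z* z - z z*. In this form it serves as a
rewriting rule between monomials in the multiplication operators. -/
theorem rzs_rz_distK (f : Dist) : rz q (rzs q (distK q f)) - rzs q (rz q (distK q f)) =
    lzs q (lz q f) - lz q (lzs q f) := by
  rw [← ry_eq, ry_distK_eq]

theorem rzs_rz_eq_distKinv (f : Dist) : rz q (rzs q f) - rzs q (rz q f) =
    lzs q (lz q (distKinv q f)) - lz q (lzs q (distKinv q f)) := by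
  rw [← rzs_rz_distK, distK_distKinv]

/-- The term coming from F(dz*) is absorbed into F f, because (q² + 1)(1 - q²) = 1 - q⁴. The result
has the shape of F on functions, with other constants. -/
theorem formF_eq (f : Dist) : formF q f = (sq q / (1 - qc q ^ 2)) •
    (qc q ^ 4 • lzs q (distKinv q f) - rzs q f) := by
  have h1 := one_sub_ne_zero q
  rw [formF_apply, distF_apply]
  match_scalars <;> field_simp
  ring

/-! ### Commutation of `∂̄` and `∂̄*` with the action of `U_q sl₂` -/

theorem distDbar_distK (f : Dist) : distDbar q (distK q f) = formK q (distDbar q f) := by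
  apply ry_injective q
  have h0 := qc_ne_zero q
  rw [formK_apply, map_smul, ry_distK, ry_distDbar, ry_distDbar, map_smul, map_sub, distK_rz,
    distK_lz]
  match_scalars <;> field_simp

theorem distDbar_distKinv (f : Dist) : distDbar q (distKinv q f) = formKinv q (distDbar q f) := by
  apply ry_injective q
  have h0 := qc_ne_zero q
  rw [formKinv_apply, map_smul, ry_distKinv, ry_distDbar, ry_distDbar, map_smul, map_sub,
    distKinv_rz, distKinv_lz]
  match_scalars <;> field_simp

/-- Up to a common constant, the two sides times y are (R - L)(L - R K) f and (L - q⁻² R K)(R - L)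
f. They agree since L and R commute and K (R - L) = q² (R - L) K. -/
theorem distDbar_distE (f : Dist) : distDbar q (distE q f) = formE q (distDbar q f) := by
  apply ry_injective q
  have h0 := qc_ne_zero q
  have h1 := one_sub_ne_zero q
  simp only [formE_apply, ry_distDbar, distE_apply, map_smul, map_sub, ry_lz, ry_rz, ry_distK,
    distK_rz, distK_lz, rz_lz]
  match_scalars <;> field_simp

theorem distDbar_distF (f : Dist) : distDbar q (distF q f) = formF q (distDbar q f) := by
  apply ry_injective q
  have h0 := qc_ne_zero q
  have h1 := one_sub_ne_zero q
  -- After normal ordering, the two sides differ by f (z* z - z z*) against (z* z - z z*) K⁻¹(f).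
  -- The relation is solved for f z* z so that it can be used as a rewriting rule.
  have e := rzs_rz_eq_distKinv q f
  rw [sub_eq_iff_eq_add] at e
  simp only [formF_eq, ry_distDbar, distF_apply, map_smul, map_sub, ry_lzs, ry_rzs, ry_distKinv,
    distKinv_rz, distKinv_lz, rz_lzs, rzs_lz, e]
  match_scalars <;> field_simp
  ring

/-! ### The formal adjoint intertwines the generators -/

theorem distDbarStar_formK (g : Dist) : distDbarStar q (formK q g) = distK q (distDbarStar q g) := by
  simp only [formK_apply, distDbarStar_apply, map_smul, map_sub, ← ry_distK, distK_rzs, distK_lzs]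
  module

theorem distDbarStar_formKinv (g : Dist) :
    distDbarStar q (formKinv q g) = distKinv q (distDbarStar q g) := by
  simp only [formKinv_apply, distDbarStar_apply, map_smul, map_sub, ← ry_distKinv, distKinv_rzs,
    distKinv_lzs]
  module

theorem distDbarStar_formE (g : Dist) : distDbarStar q (formE q g) = distE q (distDbarStar q g) := by
  have h0 := qc_ne_zero q
  have h1 := one_sub_ne_zero q
  -- The relation is taken at g y, because the exchange rules below move y next to g in every
  -- monomial.
  have e := rzs_rz_distK q (ry q g)
  rw [sub_eq_iff_eq_add] at e
  simp only [formE_apply, distDbarStar_apply, distE_apply, map_smul, map_sub, ry_lz, ry_lzs,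
    ry_rz, ry_rzs, ry_distK, distK_rzs, distK_lzs, rz_lzs, rzs_lz, e]
  match_scalars <;> field_simp
  ring

/-- Only L*, R*, K⁻¹ and y occur. The coefficients q⁴ and 1 in `formF_eq` both become q², as in F on
functions: moving K⁻¹ past R* - L* removes a q² from the first term, and moving y past R* adds a q²
to the second. -/
theorem distDbarStar_formF (g : Dist) : distDbarStar q (formF q g) = distF q (distDbarStar q g) := by
  have h0 := qc_ne_zero q
  have h1 := one_sub_ne_zero q
  simp only [formF_eq, distDbarStar_apply, distF_apply, map_smul, map_sub, ry_lzs,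
    ry_rzs, ry_distKinv, distKinv_rzs, distKinv_lzs, rzs_lzs]
  match_scalars <;> field_simp

/-- The set of ξ for which the intertwining holds for every f is a subalgebra, so the generators
suffice. -/
theorem distDbar_distAct (ξ : Uq q) (f : Dist) :
    distDbar q (distAct q ξ f) = formAct q ξ (distDbar q f) := by
  induction ξ using Uq.induction generalizing f with
  | hs c => simp only [AlgHom.commutes, Module.algebraMap_end_apply, map_smul]
  | hg g =>
    rw [distAct, formAct, Uq.lift_gen, Uq.lift_gen]
    cases g
    · exact distDbar_distK q f
    · exact distDbar_distKinv q f
    · exact distDbar_distE q f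
    · exact distDbar_distF q f
  | hm a b ha hb => simp only [map_mul, Module.End.mul_apply, ha, hb]
  | ha a b ha hb => simp only [map_add, LinearMap.add_apply, ha, hb]

theorem distDbarStar_formAct (ξ : Uq q) (g : Dist) :
    distDbarStar q (formAct q ξ g) = distAct q ξ (distDbarStar q g) := by
  induction ξ using Uq.induction generalizing g with
  | hs c => simp only [AlgHom.commutes, Module.algebraMap_end_apply, map_smul]
  | hg x =>
    rw [distAct, formAct, Uq.lift_gen, Uq.lift_gen]
    cases x
    · exact distDbarStar_formK q g
    · exact distDbarStar_formKinv q g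
    · exact distDbarStar_formE q g
    · exact distDbarStar_formF q g
  | hm a b ha hb => simp only [map_mul, Module.End.mul_apply, ha, hb]
  | ha a b ha hb => simp only [map_add, LinearMap.add_apply, ha, hb]

/-! ### The two operators as morphisms between the modules of finite elements -/

theorem distDbarStar_mem {g : Dist} (h : g ∈ finSub) : distDbarStar q g ∈ finSub :=
  finSub.smul_mem _ (diagOp_mem _ (finSub.sub_mem (rzs_mem q h) (lzs_mem q h)))

/-- `∂̄ : D(U)_q → Ω(U)_q^{(0,1)}` as a morphism of `U_q sl₂`-modules. -/
def dbarHom : DU q →ₗ[Uq q] Omega01 q where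
  toFun := dbar q
  map_add' := map_add (dbar q)
  map_smul' ξ f := Subtype.ext (distDbar_distAct q ξ f.1)

/-- `∂̄* : Ω(U)_q^{(0,1)} → D(U)_q` as a morphism of `U_q sl₂`-modules. -/
def dbarStarHom : Omega01 q →ₗ[Uq q] DU q where
  toFun ω := (⟨distDbarStar q (Omega01.coeff q ω), distDbarStar_mem q ω.2⟩ : finSub)
  map_add' ω η := Subtype.ext (map_add (distDbarStar q) ω.1 η.1)
  map_smul' ξ ω := Subtype.ext (distDbarStar_formAct q ξ ω.1)

/-! ### The adjoint -/

/-- Summation by parts: the upper boundary term vanishes by hypothesis, the lower one because `wt q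
0 = 0`. The latter also makes the value `b (0 - 1) = b 0` irrelevant. -/
theorem sum_wt_shift {N : ℕ} {a b : ℕ → ℂ} (h : a (N + 1) * b N = 0) :
    ∑ n ∈ Finset.range (N + 1), wt q (n + 1) * (a (n + 1) * b n) =
      ∑ n ∈ Finset.range (N + 1), wt q n * (a n * b (n - 1)) := by
  rw [Finset.sum_range_succ, h, Finset.sum_range_succ', wt_zero]
  simp

theorem conj_wt (m : ℕ) : conj (wt q m) = wt q m := Complex.conj_ofReal _

/-- The factor (1 - z z*)² turns the ν-weight q^{-2n} into q^{2n}, which is exactly what cancels the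
y⁻¹ in ∂̄. -/
theorem wMu_distDbar (f : Dist) (m n : ℕ) :
    (wMu q n : ℂ) * conj (distDbar q f m n) =
      wt q (n + 1) * conj (f m (n + 1)) - wt q m * conj (f (m - 1) n) := by
  have h0 := qc_ne_zero q
  have h1 := one_sub_ne_zero q
  have e1 : conj (qc q) = qc q := Complex.conj_ofReal _
  have e2 : (wMu q n : ℂ) = (1 - qc q ^ 2) * qc q ^ (2 * n) := by
    simp only [wMu, qc]; push_cast; ring
  have e3 : distDbar q f m n = ((1 - qc q ^ 2) * qc q ^ (2 * n))⁻¹ *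
      (wt q (n + 1) * f m (n + 1) - wt q m * f (m - 1) n) := rfl
  rw [e2, e3]
  simp only [map_mul, map_inv₀, map_sub, map_pow, map_one, conj_wt, e1]
  field_simp

/-- Here the factor y of the formal adjoint cancels the ν-weight, so both pairings become unweighted
sums. -/
theorem wNu_distDbarStar (g : Dist) (m n : ℕ) :
    (wNu q n : ℂ) * distDbarStar q g m n =
      wt q n * g m (n - 1) - wt q (m + 1) * g (m + 1) n := by
  have h0 := qc_ne_zero q
  have h1 := one_sub_ne_zero q
  have e2 : (wNu q n : ℂ) = (1 - qc q ^ 2) * (qc q ^ (2 * n))⁻¹ := by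
    simp only [wNu, qc]; push_cast; ring
  have e3 : distDbarStar q g m n = (1 - qc q ^ 2)⁻¹ * (qc q ^ (2 * n) *
      (wt q n * g m (n - 1) - wt q (m + 1) * g (m + 1) n)) := rfl
  rw [e2, e3]
  field_simp

theorem gram_distDbar {N : ℕ} {f g : Dist} (hf : Bdd N f) (hg : Bdd N g) :
    gram (wMu q) (N + 1) (distDbar q f) g = gram (wNu q) (N + 1) f (distDbarStar q g) := by
  have e1 : ∀ m n, (wMu q n : ℂ) * (conj (distDbar q f m n) * g m n) =
      wt q (n + 1) * (conj (f m (n + 1)) * g m n) - wt q m * (g m n * conj (f (m - 1) n)) :=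
    fun m n => by rw [← mul_assoc, wMu_distDbar]; ring
  have e2 : ∀ m n, (wNu q n : ℂ) * (conj (f m n) * distDbarStar q g m n) =
      wt q n * (conj (f m n) * g m (n - 1)) - wt q (m + 1) * (g (m + 1) n * conj (f m n)) :=
    fun m n => by rw [mul_left_comm, wNu_distDbarStar]; ring
  simp only [gram, e1, e2, Finset.sum_sub_distrib]
  congr 1
  -- Right multiplication shifts the column index n, which is the outer variable, hence the exchange
  -- of sums. In the other half the row index m is shifted, and it is already the inner one.
  · rw [Finset.sum_comm, Finset.sum_comm (s := Finset.range (N + 1)) (t := Finset.range (N + 1))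
      (f := fun n m => wt q n * (conj (f m n) * g m (n - 1)))]
    refine Finset.sum_congr rfl fun m _ => ?_
    exact sum_wt_shift q (a := fun n => conj (f m n)) (by simp [hf m (N + 1) (by omega)])
  · refine Finset.sum_congr rfl fun n _ => ?_
    exact (sum_wt_shift q (a := fun m => g m n) (b := fun m => conj (f m n))
      (by simp [hg (N + 1) n (by omega)])).symm

/-! ### Passage to the Hilbert spaces -/

theorem inner_dbar (f : DU q) (ω : Omega01 q) :
    @inner ℂ (Omega01 q) InnerProductSpace.toInner (dbar q f) ω =
      @inner ℂ (DU q) InnerProductSpace.toInner f (dbarStarHom q ω) := by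
  obtain ⟨N, hN⟩ := exists_bdd f
  obtain ⟨M, hM⟩ := exists_bdd ω
  have hf : Bdd (max N M) (DU.toDist q f) := Bdd.mono (f := f.1) hN (le_max_left N M)
  have hg : Bdd (max N M) (Omega01.coeff q ω) := Bdd.mono (f := ω.1) hM (le_max_right N M)
  -- The term z f shifts rows by one, so ∂̄ f needs a block larger by one. Both scalar products
  -- reduce to finite sums once their first argument is bounded, so nothing is needed about the
  -- support of the formal adjoint.
  have hd : Bdd (max N M + 1) (distDbar q (DU.toDist q f)) := by
    intro m n h
    simp [distDbar, diagOp, rz, lz, hf m (n + 1) (by omega), hf (m - 1) n (by omega)]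
  rw [inner_Omega01, inner_DU, coeff_dbar, innerMu_eq q hd,
    innerNu_eq q (hf.mono (Nat.le_succ _)), gram_distDbar q hf hg]
  rfl

/-- A vector of the completion is determined by its scalar products with finite functions, and on
those the bounded extension of ∂̄ is ∂̄ itself. Thus the formal adjoint is the actual one, and its
values are finite. -/
theorem dbarStar_iMu (ω : Omega01 q) : dbarStar q (iMu q ω) = iNu q (dbarStarHom q ω) := by
  refine (denseRange_iNu q).eq_of_inner_right ℂ fun f => ?_
  rw [dbarStar, ContinuousLinearMap.adjoint_inner_right, dbarL2_iNu]
  exact (UniformSpace.Completion.inner_coe _ _).trans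
    ((inner_dbar q f ω).trans (UniformSpace.Completion.inner_coe _ _).symm)

end QDisc

end

theorem theorem4p3 (q : QDisc.Par) :
    DenseRange (QDisc.iMu q) ∧ DenseRange (QDisc.iNu q) ∧
    (∃ Φ : QDisc.Omega01 q →ₗ[QDisc.Uq q] QDisc.DU q,
      ∀ ω : QDisc.Omega01 q, QDisc.dbarStar q (QDisc.iMu q ω) = QDisc.iNu q (Φ ω)) ∧
    (∃ Ψ : QDisc.DU q →ₗ[QDisc.Uq q] QDisc.DU q,
      ∀ f : QDisc.DU q, QDisc.box q (QDisc.iNu q f) = QDisc.iNu q (Ψ f)) := by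
  refine ⟨UniformSpace.Completion.denseRange_coe, QDisc.denseRange_iNu q,
    ⟨QDisc.dbarStarHom q, QDisc.dbarStar_iMu q⟩,
    ⟨-(QDisc.dbarStarHom q ∘ₗ QDisc.dbarHom q), fun f => ?_⟩⟩
  have h : QDisc.box q (QDisc.iNu q f) =
      -(QDisc.dbarStar q (QDisc.dbarL2 q (QDisc.iNu q f))) := rfl
  -- ∂̄ keeps finite functions among the finite forms, so the formula for the adjoint applies to ∂̄
  -- f; the sign passes through the linear inclusion.
  rw [h, QDisc.dbarL2_iNu, QDisc.dbarStar_iMu, ← map_neg]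
  rfl
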